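/- Let $G(k,n)$ be the real Grassmannian of $k$-dimensional linear subspaces of $\mathbb{R}^n$, with $k \le n-k$. Principal vectors $(p_1,q_1),\dots,(p_k,q_k)$ between $\mathbf{L},\mathbf{W}\in G(k,n)$ are defined recursively: $(p_i,q_i)$ maximizes $\langle p,q\rangle$ among the unit vectors $p\in\mathbf{L}$, $q\in\mathbf{W}$ with $p\perp p_1,\dots,p_{i-1}$ and $q\perp q_1,\dots,q_{i-1}$. The principal angles are $\theta_i(\mathbf{L},\mathbf{W})=\arccos\langle p_i,q_i\rangle$, so that $0\le\theta_1\le\dots\le\theta_k\le\frac{\pi}{2}$, and the Grassmann distance is $\delta(\mathbf{L},\mathbf{E})=\big(\sum_{i=1}^k\theta_i(\mathbf{L},\mathbf{E})^2\big)^{1/2}$. Identify the tangent space of $G(k,n)$ at $\mathbf{W}$ with the space of linear maps $A:\mathbf{W}\to\mathbf{W}^\perp$; then the Riemannian exponential map is $\exp_{\mathbf{W}}(A)=e^{M_A}\mathbf{W}$, where $M_A=\begin{pmatrix}0&-A^{\top}\\A&0\end{pmatrix}$ with respect to $\mathbb{R}^n=\mathbf{W}\oplus\mathbf{W}^\perp$.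 Fix $\mathbf{W}\in G(k,n)$ and $1\le s\le k$, and let $$\Omega_s=\{\mathbf{E}\in G(k,n)\mid \dim(\mathbf{E}\cap\mathbf{W})\ge s\}.$$ Write $\delta_{\mathbf{L}}(\mathbf{E})=\delta(\mathbf{L},\mathbf{E})$ and $\theta_i(\mathbf{L})=\theta_i(\mathbf{L},\mathbf{W})$. The generic $\mathbf{L}\in G(k,n)$ (that is, every $\mathbf{L}$ off some real algebraic subset of $G(k,n)$ with dense complement) satisfies $\mathbf{L}\notin\Omega_s$ and $$0<\theta_1(\mathbf{L})<\dots<\theta_k(\mathbf{L})<\tfrac{\pi}{2}.$$ For every $\mathbf{L}$ with $0<\theta_1(\mathbf{L})<\dots<\theta_k(\mathbf{L})<\frac{\pi}{2}$, with any principal vectors $\{p_1,\dots,p_k\}\subset\mathbf{L}$ and $\{q_1,\dots,q_k\}\subset\mathbf{W}$, the restriction of $\delta_{\mathbf{L}}$ to $\Omega_s$ has a unique global minimizer, namely $$\mathbf{E}_m=\mathrm{span}\{q_1,\dots,q_s,p_{s+1},\dots,p_k\},$$ and $$\min\delta_{\mathbf{L}}|_{\Omega_s}=\delta_{\mathbf{L}}(\mathbf{E}_m)=\left(\theta_1(\mathbf{L})^2+\dots+\theta_s(\mathbf{L})^2\right)^{1/2}.$$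 Moreover $\mathbf{E}_m$ is the Eckart–Young point: there is a unique linear map $A_{\mathbf{L}}:\mathbf{W}\to\mathbf{W}^\perp$ with all singular values at most $\frac{\pi}{2}$ and $\exp_{\mathbf{W}}(A_{\mathbf{L}})=\mathbf{L}$; among the linear maps $\mathbf{W}\to\mathbf{W}^\perp$ of rank at most $k-s$ there is a unique one, $B$, that minimizes the Frobenius distance to $A_{\mathbf{L}}$; and $\mathbf{E}_m=\exp_{\mathbf{W}}(B)$. -/

import Mathlib

noncomputable section

namespace NonlinearEckartYoung

/-- Euclidean space `ℝⁿ`. -/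
abbrev Vec (n : ℕ) : Type := EuclideanSpace ℝ (Fin n)

/-- The real Grassmannian `G(k, n)`: the `k`-dimensional linear subspaces of `ℝⁿ`. -/
@[ext]
structure Gr (k n : ℕ) : Type where
  /-- The underlying subspace. -/
  plane : Submodule ℝ (Vec n)
  /-- It has dimension `k`. -/
  finrank_eq : Module.finrank ℝ plane = k

/-- The standard topology of `G(k, n)`, through the embedding that sends a plane to the orthogonal
projection onto it. -/
instance (k n : ℕ) : TopologicalSpace (Gr k n) :=
  TopologicalSpace.induced (fun E => E.plane.starProjection) inferInstance

/-- The entry `(i, j)` of the matrix of the orthogonal projection onto `E`. -/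
def Gr.projEntry {k n : ℕ} (E : Gr k n) (ij : Fin n × Fin n) : ℝ :=
  E.plane.starProjection (EuclideanSpace.single ij.2 1) ij.1

/-- `P` holds for the generic point of `G(k, n)`: it holds off the zero locus of a polynomial (in
the entries of the projection matrix, i.e. off a real algebraic subset of `G(k, n)`), and the
complement of this zero locus is dense. -/
def IsGeneric {k n : ℕ} (P : Gr k n → Prop) : Prop :=
  ∃ F : MvPolynomial (Fin n × Fin n) ℝ,
    Dense {E : Gr k n | MvPolynomial.eval E.projEntry F ≠ 0} ∧
    ∀ E : Gr k n, MvPolynomial.eval E.projEntry F ≠ 0 → P E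

/-- The constraints of the `i`-th optimization problem that defines principal vectors: unit vectors
`x ∈ E` and `y ∈ F`, with `x` orthogonal to `p j` and `y` orthogonal to `q j` for `j < i`. -/
def Feasible {n m : ℕ} (E F : Submodule ℝ (Vec n)) (p q : Fin m → Vec n) (i : ℕ)
    (x y : Vec n) : Prop :=
  (x ∈ E ∧ ‖x‖ = 1 ∧ ∀ j : Fin m, (j : ℕ) < i → inner ℝ x (p j) = 0) ∧
  (y ∈ F ∧ ‖y‖ = 1 ∧ ∀ j : Fin m, (j : ℕ) < i → inner ℝ y (q j) = 0)

/-- `(p 0, q 0), …, (p (m - 1), q (m - 1))` are produced by the recursive algorithm for principal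
vectors between `E` and `F`: each pair maximizes the scalar product among the feasible pairs. -/
def IsPrincipalVectors {n m : ℕ} (E F : Submodule ℝ (Vec n)) (p q : Fin m → Vec n) : Prop :=
  ∀ i : Fin m, Feasible E F p q i (p i) (q i) ∧
    ∀ x y : Vec n, Feasible E F p q i x y → inner ℝ x y ≤ inner ℝ (p i) (q i)

/-- A unit vector of `E` orthogonal to fewer than `dim E` given vectors. -/
theorem exists_unit_orthogonal {n m : ℕ} (E : Submodule ℝ (Vec n))
    (h : m < Module.finrank ℝ E) (p : Fin m → Vec n) :
    ∃ x ∈ E, ‖x‖ = 1 ∧ ∀ j, inner ℝ x (p j) = 0 := by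
  let f : E →ₗ[ℝ] (Fin m → ℝ) :=
    LinearMap.pi fun j => (innerₛₗ ℝ (p j)).comp E.subtype
  have hf : LinearMap.ker f ≠ ⊥ := LinearMap.ker_ne_bot_of_finrank_lt (by simpa using h)
  obtain ⟨v, hv, hv0⟩ := (Submodule.ne_bot_iff _).1 hf
  have hv0' : (v : Vec n) ≠ 0 := by simpa using hv0
  refine ⟨(‖(v : Vec n)‖⁻¹) • (v : Vec n), E.smul_mem _ v.2, ?_, fun j => ?_⟩
  · rw [norm_smul, norm_inv, norm_norm, inv_mul_cancel₀ (norm_ne_zero_iff.2 hv0')]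
  · have h1 : inner ℝ (p j) (v : Vec n) = 0 := congrFun (LinearMap.mem_ker.1 hv) j
    rw [real_inner_smul_left, real_inner_comm, h1, mul_zero]

/-- The unit vectors of `E` orthogonal to given vectors form a compact set. -/
theorem isCompact_unit_orthogonal {n m : ℕ} (E : Submodule ℝ (Vec n)) (p : Fin m → Vec n) :
    IsCompact {x : Vec n | x ∈ E ∧ ‖x‖ = 1 ∧ ∀ j, inner ℝ x (p j) = 0} := by
  refine (isCompact_sphere (0 : Vec n) 1).of_isClosed_subset ?_ fun x hx => by simpa using hx.2.1
  refine (Submodule.closed_of_finiteDimensional E).inter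
    ((isClosed_eq continuous_norm continuous_const).inter ?_)
  have : {x : Vec n | ∀ j, inner ℝ x (p j) = 0} = ⋂ j, {x : Vec n | inner ℝ x (p j) = 0} := by
    ext x; simp
  change IsClosed {x : Vec n | ∀ j, inner ℝ x (p j) = 0}
  rw [this]
  exact isClosed_iInter fun j => isClosed_eq (continuous_id.inner continuous_const) continuous_const

/-- Principal vectors exist. -/
theorem exists_isPrincipalVectors {n : ℕ} (E F : Submodule ℝ (Vec n)) (m : ℕ)
    (hE : m ≤ Module.finrank ℝ E) (hF : m ≤ Module.finrank ℝ F) :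
    ∃ p q : Fin m → Vec n, IsPrincipalVectors E F p q := by
  induction m with
  | zero => exact ⟨Fin.elim0, Fin.elim0, fun i => i.elim0⟩
  | succ m ih =>
    obtain ⟨p, q, hpq⟩ := ih (by omega) (by omega)
    obtain ⟨x₀, hx₀⟩ := exists_unit_orthogonal E (by omega) p
    obtain ⟨y₀, hy₀⟩ := exists_unit_orthogonal F (by omega) q
    obtain ⟨⟨x, y⟩, ⟨hx, hy⟩, hmax⟩ :=
      ((isCompact_unit_orthogonal E p).prod (isCompact_unit_orthogonal F q)).exists_isMaxOn
        ⟨(x₀, y₀), hx₀, hy₀⟩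
        (f := fun z : Vec n × Vec n => inner ℝ z.1 z.2)
        (continuous_fst.inner continuous_snd).continuousOn
    have key : ∀ (i : ℕ), i ≤ m → ∀ a b : Vec n,
        Feasible E F (Fin.snoc p x : Fin (m + 1) → Vec n) (Fin.snoc q y) i a b ↔
          Feasible E F p q i a b := by
      intro i hi a b
      have aux : ∀ (r : Fin m → Vec n) (z c : Vec n),
          (∀ j : Fin (m + 1), (j : ℕ) < i →
            inner ℝ c ((Fin.snoc r z : Fin (m + 1) → Vec n) j) = 0) ↔
          ∀ j : Fin m, (j : ℕ) < i → inner ℝ c (r j) = 0 := by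
        intro r z c
        constructor
        · intro h j hj
          simpa using h j.castSucc (by simpa using hj)
        · intro h j
          refine Fin.lastCases (fun hj => ?_) (fun j hj => ?_) j
          · simp at hj; omega
          · simpa using h j (by simpa using hj)
      simp only [Feasible, aux]
    refine ⟨Fin.snoc p x, Fin.snoc q y, fun i => ?_⟩
    refine Fin.lastCases ?_ (fun i => ?_) i
    · simp only [Fin.snoc_last, Fin.val_last, key m le_rfl]
      refine ⟨⟨⟨hx.1, hx.2.1, fun j _ => hx.2.2 j⟩, hy.1, hy.2.1, fun j _ => hy.2.2 j⟩, ?_⟩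
      intro a b hab
      exact hmax (show (a, b) ∈ _ from
        ⟨⟨hab.1.1, hab.1.2.1, fun j => hab.1.2.2 j j.2⟩,
          hab.2.1, hab.2.2.1, fun j => hab.2.2.2 j j.2⟩)
    · simp only [Fin.snoc_castSucc, Fin.val_castSucc, key i i.2.le]
      exact hpq i

/-- The `i`-th principal angle `θ_{i + 1}` between two `k`-planes, `i = 0, …, k - 1`. -/
def principalAngle {k n : ℕ} (E F : Gr k n) (i : Fin k) : ℝ :=
  let h := exists_isPrincipalVectors E.plane F.plane k E.finrank_eq.ge F.finrank_eq.ge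
  Real.arccos (inner ℝ (h.choose i) (h.choose_spec.choose i))

/-- The Grassmann distance `δ(E, F) = (θ₁² + ⋯ + θ_k²)^{1/2}`. -/
def grassmannDist {k n : ℕ} (E F : Gr k n) : ℝ :=
  √(∑ i, principalAngle E F i ^ 2)

/-- The simple Schubert variety `Ω_s(W) = {E | dim (E ∩ W) ≥ s}`. -/
def schubert {k n : ℕ} (W : Gr k n) (s : ℕ) : Set (Gr k n) :=
  {E | s ≤ Module.finrank ℝ ↥(E.plane ⊓ W.plane)}

/-- The principal angles satisfy `0 < θ₁ < ⋯ < θ_k < π / 2`. -/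
def HasDistinctAngles {k n : ℕ} (L W : Gr k n) : Prop :=
  (∀ i, 0 < principalAngle L W i) ∧ StrictMono (principalAngle L W) ∧
    ∀ i, principalAngle L W i < Real.pi / 2

/-- The tangent space of `G(k, n)` at `W`, as `Hom(W, W^⊥)`; after a choice of orthonormal bases of
`W` and `W^⊥` these are the matrices of size `(n - k) × k`. -/
abbrev Tangent {k n : ℕ} (W : Gr k n) : Type := ↥W.plane →ₗ[ℝ] ↥W.planeᗮ

/-- The skew-symmetric endomorphism `M_A` of `ℝⁿ = W ⊕ W^⊥` with blocks `0, -Aᵀ, A, 0`. -/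
def skew {k n : ℕ} (W : Gr k n) (A : Tangent W) : Vec n →L[ℝ] Vec n :=
  LinearMap.toContinuousLinearMap
    (W.planeᗮ.subtype ∘ₗ A ∘ₗ W.plane.orthogonalProjectionOnto.toLinearMap -
      W.plane.subtype ∘ₗ A.adjoint ∘ₗ W.planeᗮ.orthogonalProjectionOnto.toLinearMap)

/-- The Riemannian exponential map of `G(k, n)` at `W`: `exp_W(A) = e^{M_A} · W`. -/
def grExp {k n : ℕ} (W : Gr k n) (A : Tangent W) : Gr k n where
  plane := W.plane.map (NormedSpace.exp (skew W A) : Vec n →L[ℝ] Vec n).toLinearMap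
  finrank_eq := by
    have hinj : Function.Injective (NormedSpace.exp (skew W A) : Vec n →L[ℝ] Vec n) := by
      let _ : NormedAlgebra ℚ (Vec n →L[ℝ] Vec n) := NormedAlgebra.restrictScalars ℚ ℝ _
      have h := NormedSpace.exp_add_of_commute
        (Commute.neg_left (Commute.refl (skew W A)))
      rw [neg_add_cancel, NormedSpace.exp_zero] at h
      exact Function.LeftInverse.injective
        (g := (NormedSpace.exp (-skew W A) : Vec n →L[ℝ] Vec n))
        fun x => (DFunLike.congr_fun h x).symm
    exact (Submodule.equivMapOfInjective _ hinj W.plane).finrank_eq.symm.trans W.finrank_eq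

/-- The Frobenius norm `tr(AᵀA)^{1/2}`. -/
def frobNorm {k n : ℕ} {W : Gr k n} (A : Tangent W) : ℝ :=
  √(LinearMap.trace ℝ W.plane (A.adjoint ∘ₗ A))

/-- `A` belongs to `R_{π/2}` (all singular values are at most `π / 2`) and `exp_W(A) = L`. -/
def IsGrLog {k n : ℕ} (W L : Gr k n) (A : Tangent W) : Prop :=
  (∀ i, A.singularValues i ≤ Real.pi / 2) ∧ grExp W A = L

/-- `B` is a solution of the Eckart-Young problem for `A` and `r`: it has rank at most `r` and
minimizes the Frobenius distance to `A` among all `C` of rank at most `r`. -/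
def IsBestApprox {k n : ℕ} {W : Gr k n} (A : Tangent W) (r : ℕ) (B : Tangent W) : Prop :=
  Module.finrank ℝ (LinearMap.range B) ≤ r ∧
    ∀ C : Tangent W, Module.finrank ℝ (LinearMap.range C) ≤ r → frobNorm (A - B) ≤ frobNorm (A - C)

/-- `E` is the Eckart-Young point for `L` in `Ω_s(W)`: there is exactly one `A ∈ R_{π/2}` with
`exp_W(A) = L`, this `A` has exactly one best approximation `B` of rank at most `k - s`, and
`E = exp_W(B)`. -/
def IsEckartYoungPoint {k n : ℕ} (W L : Gr k n) (s : ℕ) (E : Gr k n) : Prop :=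
  ∃ A : Tangent W, (IsGrLog W L A ∧ ∀ A', IsGrLog W L A' → A' = A) ∧
    ∃ B : Tangent W, (IsBestApprox A (k - s) B ∧ ∀ B', IsBestApprox A (k - s) B' → B' = B) ∧
      E = grExp W B

end NonlinearEckartYoung

end

/-! Principal vectors are a singular value decomposition of the scalar product between `L` and `W`:
maximality forces `⟨p i, q j⟩` to be diagonal with entries `cos θ i`
(`IsPrincipalVectors.inner_eq_zero_of_lt`). Interlacing (`Biorthogonal.le_of_finrank_inf`) shows
that these entries do not depend on the bases.

For `E` in `Ω_s`, the same interlacing applied to `E` and `W`, which share `s` dimensions, bounds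
the angles between `L` and `E` below by `0, …, 0, θ₁, …, θ_s`. This is the lower bound for the
distance, and `E_m` attains it. If `E` attains it too, then `tr(P_L P_E) = (k - s) + cos² θ₁ + ⋯ +
cos² θ_s`. In an orthonormal basis of `E` whose first `s` vectors lie in `W`, this trace can only be
so large if the last vectors lie in `L` and the first ones, the cosines being distinct, span the
same space as `q₁, …, q_s`; hence `E = E_m` (`plane_le_of_sum_le`).

Write `p i = cos θ i • q i + sin θ i • u i` with `u` orthonormal in `W^⊥`. If `A` maps `q i` to `θ i
• u i`, then `M_A` generates the rotation of each plane `span(q i, u i)`, so `exp_W(A) = L`. Any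
other logarithm is compared with `A` through the eigenvectors of `P_W P_L` in `W`. The best
approximation of `A` replaces `θ₁, …, θ_s` by `0`, which turns `p i` into `q i` for these indices
and gives `E_m`. Its uniqueness and that of the minimizer use the same equality case,
`sum_filter_lt_le_sum_mul`.

For genericity, the numbers `cos² θ i` are the eigenvalues of the compression of `P_L` to `W`, so a
determinant times a discriminant is the required polynomial. Its nonvanishing locus is dense because
the angles can be perturbed while the directions stay fixed. -/

namespace NonlinearEckartYoung

/-! ### Orthonormal bases of subspaces -/

/-- `p` is an orthonormal family that spans `E`. -/
structure IsONSpan {n : ℕ} {ι : Type*} (E : Submodule ℝ (Vec n)) (p : ι → Vec n) : Prop where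
  orthonormal : Orthonormal ℝ p
  span_eq : Submodule.span ℝ (Set.range p) = E

namespace IsONSpan

variable {n : ℕ} {ι : Type*} {E : Submodule ℝ (Vec n)} {p : ι → Vec n}

theorem mem (h : IsONSpan E p) (i : ι) : p i ∈ E :=
  h.span_eq ▸ Submodule.subset_span ⟨i, rfl⟩

theorem inner_eq [DecidableEq ι] (h : IsONSpan E p) (i j : ι) :
    inner ℝ (p i) (p j) = if i = j then (1 : ℝ) else 0 :=
  orthonormal_iff_ite.1 h.orthonormal i j

theorem norm_eq (h : IsONSpan E p) (i : ι) : ‖p i‖ = 1 := h.orthonormal.1 i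

theorem of_finrank [Fintype ι] (ho : Orthonormal ℝ p) (hm : ∀ i, p i ∈ E)
    (hE : Module.finrank ℝ E = Fintype.card ι) : IsONSpan E p := by
  refine ⟨ho, Submodule.eq_of_le_of_finrank_eq ?_ ?_⟩
  · rw [Submodule.span_le]
    rintro _ ⟨i, rfl⟩
    exact hm i
  · rw [finrank_span_eq_card ho.linearIndependent, hE]

theorem finrank_eq [Fintype ι] (h : IsONSpan E p) : Module.finrank ℝ E = Fintype.card ι := by
  rw [← h.span_eq, finrank_span_eq_card h.orthonormal.linearIndependent]

theorem comp_equiv {κ : Type*} (h : IsONSpan E p) (e : κ ≃ ι) : IsONSpan E (p ∘ e) :=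
  ⟨h.orthonormal.comp e e.injective, by rw [e.surjective.range_comp, h.span_eq]⟩

/-- The family as an orthonormal basis of the subspace. -/
noncomputable def basis [Fintype ι] (h : IsONSpan E p) : OrthonormalBasis ι ℝ E :=
  OrthonormalBasis.mk (v := fun i => (⟨p i, h.mem i⟩ : E))
    (by
      refine ⟨fun i => h.orthonormal.1 i, fun i j hij => ?_⟩
      exact h.orthonormal.2 hij)
    (by
      rw [← Submodule.map_le_map_iff_of_injective E.injective_subtype, Submodule.map_span,
        ← Set.range_comp]
      have h2 : (E.subtype ∘ fun i => (⟨p i, h.mem i⟩ : E)) = p := rfl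
      rw [h2, h.span_eq, Submodule.map_top, Submodule.range_subtype])

@[simp]
theorem coe_basis [Fintype ι] (h : IsONSpan E p) (i : ι) : (h.basis i : Vec n) = p i :=
  congrArg Subtype.val (congrFun (OrthonormalBasis.coe_mk _ _) i)

theorem of_basis [Fintype ι] (b : OrthonormalBasis ι ℝ E) :
    IsONSpan E (fun i => (b i : Vec n)) := by
  have ho : Orthonormal ℝ (fun i => (b i : Vec n)) := b.orthonormal.comp_linearIsometry E.subtypeₗᵢ
  exact of_finrank ho (fun i => (b i).2) (Module.finrank_eq_card_basis b.toBasis)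

theorem starProjection_apply [Fintype ι] (h : IsONSpan E p) (x : Vec n) :
    E.starProjection x = ∑ i, (inner ℝ (p i) x : ℝ) • p i := by
  refine Submodule.eq_starProjection_of_mem_of_inner_eq_zero
    (Submodule.sum_mem _ fun i _ => E.smul_mem _ (h.mem i)) fun w hw => ?_
  rw [← h.span_eq] at hw
  induction hw using Submodule.span_induction with
  | mem w hw =>
    obtain ⟨j, rfl⟩ := hw
    classical
    rw [inner_sub_left, sum_inner]
    simp only [real_inner_smul_left, h.inner_eq, mul_ite, mul_one, mul_zero, Finset.sum_ite_eq',
      Finset.mem_univ, if_true]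
    rw [real_inner_comm, sub_self]
  | zero => simp
  | add a b _ _ ha hb => rw [inner_add_right, ha, hb, add_zero]
  | smul c a _ ha => rw [inner_smul_right, ha, mul_zero]

theorem eq_sum [Fintype ι] (h : IsONSpan E p) {x : Vec n} (hx : x ∈ E) :
    x = ∑ i, (inner ℝ (p i) x : ℝ) • p i := by
  rw [← h.starProjection_apply, Submodule.starProjection_eq_self_iff.2 hx]

theorem norm_sq_sum [Fintype ι] (h : IsONSpan E p) (c : ι → ℝ) :
    ‖∑ i, c i • p i‖ ^ 2 = ∑ i, c i ^ 2 := by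
  classical
  rw [← real_inner_self_eq_norm_sq, h.orthonormal.inner_sum]
  simp [sq]

theorem norm_sq_starProjection [Fintype ι] (h : IsONSpan E p) (x : Vec n) :
    ‖E.starProjection x‖ ^ 2 = ∑ i, (inner ℝ (p i) x : ℝ) ^ 2 := by
  rw [h.starProjection_apply, h.norm_sq_sum]

theorem norm_sq_eq [Fintype ι] (h : IsONSpan E p) {x : Vec n} (hx : x ∈ E) :
    ‖x‖ ^ 2 = ∑ i, (inner ℝ (p i) x : ℝ) ^ 2 := by
  rw [← h.norm_sq_starProjection, Submodule.starProjection_eq_self_iff.2 hx]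

/-- Both sides are `tr(P_E P_F)`, so the sum may be evaluated in whichever orthonormal bases are
convenient. -/
theorem sum_norm_sq_starProjection_comm [Fintype ι] {κ : Type*} [Fintype κ]
    {F : Submodule ℝ (Vec n)} {q : κ → Vec n} (h : IsONSpan E p) (hq : IsONSpan F q) :
    ∑ j, ‖E.starProjection (q j)‖ ^ 2 = ∑ i, ‖F.starProjection (p i)‖ ^ 2 := by
  simp_rw [h.norm_sq_starProjection, hq.norm_sq_starProjection]
  rw [Finset.sum_comm]
  simp_rw [real_inner_comm]

end IsONSpan

/-- An orthonormal basis of `E` that starts in a given subspace `N`. -/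
theorem exists_isONSpan_of_le {n k s : ℕ} {E N : Submodule ℝ (Vec n)} (hN : N ≤ E)
    (hE : Module.finrank ℝ E = k) (hs : s ≤ Module.finrank ℝ N) :
    ∃ b : Fin k → Vec n, IsONSpan E b ∧ ∀ i : Fin k, (i : ℕ) < s → b i ∈ N := by
  let c := stdOrthonormalBasis ℝ N
  let v : Fin k → E := fun i =>
    if h : (i : ℕ) < Module.finrank ℝ N then ⟨c ⟨i, h⟩, hN (c ⟨i, h⟩).2⟩ else 0
  have hv : Orthonormal ℝ (({i : Fin k | (i : ℕ) < s} : Set (Fin k)).domRestrict v) := by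
    rw [orthonormal_iff_ite]
    rintro ⟨i, hi⟩ ⟨j, hj⟩
    have hi' : (i : ℕ) < Module.finrank ℝ N := lt_of_lt_of_le hi hs
    have hj' : (j : ℕ) < Module.finrank ℝ N := lt_of_lt_of_le hj hs
    have := orthonormal_iff_ite.1 c.orthonormal ⟨i, hi'⟩ ⟨j, hj'⟩
    simp only [Set.domRestrict_apply, v, dif_pos hi', dif_pos hj']
    simpa [Fin.ext_iff] using this
  obtain ⟨b, hb⟩ := hv.exists_orthonormalBasis_extension_of_card_eq (by simpa using hE)
  refine ⟨fun i => b i, IsONSpan.of_basis b, fun i hi => ?_⟩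
  have hi' : (i : ℕ) < Module.finrank ℝ N := lt_of_lt_of_le hi hs
  have hbi : b i = ⟨c ⟨i, hi'⟩, hN (c ⟨i, hi'⟩).2⟩ := by
    rw [hb i hi]
    simp only [v, dif_pos hi']
  change (b i : Vec n) ∈ N
  rw [hbi]
  exact (c _).2

theorem exists_unit_orthogonal_of_fintype {n : ℕ} {ι : Type*} [Fintype ι]
    (E : Submodule ℝ (Vec n)) (h : Fintype.card ι < Module.finrank ℝ E) (p : ι → Vec n) :
    ∃ x ∈ E, ‖x‖ = 1 ∧ ∀ j, inner ℝ x (p j) = 0 := by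
  obtain ⟨x, hx, h1, h2⟩ := exists_unit_orthogonal E h (p ∘ (Fintype.equivFin ι).symm)
  exact ⟨x, hx, h1, fun j => by simpa using h2 (Fintype.equivFin ι j)⟩

/-! ### Biorthogonal bases and interlacing of singular values -/

/-- `p` and `q` are orthonormal bases of `E` and `F` with respect to which the matrix of scalar
products is diagonal, with nonnegative entries `σ`. -/
structure Biorthogonal {n k : ℕ} (E F : Submodule ℝ (Vec n)) (p q : Fin k → Vec n)
    (σ : Fin k → ℝ) : Prop where
  left : IsONSpan E p
  right : IsONSpan F q
  inner_eq : ∀ i j, inner ℝ (p i) (q j) = if i = j then σ i else 0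
  nonneg : ∀ i, 0 ≤ σ i

namespace Biorthogonal

variable {n k : ℕ} {E F : Submodule ℝ (Vec n)} {p q : Fin k → Vec n} {σ : Fin k → ℝ}

theorem symm (h : Biorthogonal E F p q σ) : Biorthogonal F E q p σ where
  left := h.right
  right := h.left
  inner_eq i j := by
    rw [real_inner_comm, h.inner_eq]
    by_cases hij : i = j
    · simp [hij]
    · simp [hij, Ne.symm hij]
  nonneg := h.nonneg

theorem le_one (h : Biorthogonal E F p q σ) (i : Fin k) : σ i ≤ 1 := by
  have h1 := real_inner_le_norm (p i) (q i)
  rwa [h.inner_eq, if_pos rfl, h.left.norm_eq, h.right.norm_eq, one_mul] at h1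

theorem comp_perm (h : Biorthogonal E F p q σ) (e : Equiv.Perm (Fin k)) :
    Biorthogonal E F (p ∘ e) (q ∘ e) (σ ∘ e) where
  left := h.left.comp_equiv e
  right := h.right.comp_equiv e
  inner_eq i j := by simp [h.inner_eq]
  nonneg i := h.nonneg _

theorem starProjection_right (h : Biorthogonal E F p q σ) (i : Fin k) :
    F.starProjection (p i) = σ i • q i := by
  rw [h.right.starProjection_apply]
  simp [h.symm.inner_eq]

theorem starProjection_left (h : Biorthogonal E F p q σ) (i : Fin k) :
    E.starProjection (q i) = σ i • p i :=
  h.symm.starProjection_right i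

theorem inner_left (h : Biorthogonal E F p q σ) {y : Vec n} (hy : y ∈ F) (i : Fin k) :
    inner ℝ (p i) y = σ i * inner ℝ (q i) y := by
  rw [← Submodule.starProjection_eq_self_iff.2 hy, ← Submodule.inner_starProjection_left_eq_right,
    h.starProjection_right, real_inner_smul_left, Submodule.starProjection_eq_self_iff.2 hy]

theorem norm_sq_starProjection_left (h : Biorthogonal E F p q σ) {y : Vec n} (hy : y ∈ F) :
    ‖E.starProjection y‖ ^ 2 = ∑ i, σ i ^ 2 * (inner ℝ (q i) y : ℝ) ^ 2 := by
  rw [h.left.norm_sq_starProjection]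
  simp_rw [h.inner_left hy, mul_pow]

/-- Singular values interlace: compare those between `L` and `F` with those between `L` and `F'`
when `F ∩ F'` is large. -/
theorem le_of_finrank_inf {F' : Submodule ℝ (Vec n)} {p' q' : Fin k → Vec n} {σ' : Fin k → ℝ}
    (h : Biorthogonal E F p q σ) (hσ : Antitone σ) (h' : Biorthogonal E F' p' q' σ')
    (hσ' : Antitone σ') {s : ℕ} (hs : s ≤ Module.finrank ℝ ↥(F' ⊓ F)) {i j : Fin k}
    (hij : (j : ℕ) + k ≤ i + s) : σ' i ≤ σ j := by
  -- There are `j + (k - 1 - i) < s` orthogonality conditions, so `F' ⊓ F` contains such a `y`. It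
  -- lies in the span of the `q' a` with `a ≤ i`, where `P_E` stretches by at least `σ' i`, and of
  -- the `q a` with `a ≥ j`, where it stretches by at most `σ j`.
  obtain ⟨y, hy, hy1, hyo⟩ := exists_unit_orthogonal_of_fintype (F' ⊓ F)
    (ι := Finset.Iio j ⊕ Finset.Ioi i)
    (by simp only [Fintype.card_sum, Fintype.card_coe, Fin.card_Iio, Fin.card_Ioi]; omega)
    (Sum.elim (fun a => q a) (fun a => q' a))
  have hq : ∀ a < j, inner ℝ (q a) y = 0 := fun a ha => by
    rw [real_inner_comm]; exact hyo (Sum.inl ⟨a, Finset.mem_Iio.2 ha⟩)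
  have hq' : ∀ a > i, inner ℝ (q' a) y = 0 := fun a ha => by
    rw [real_inner_comm]; exact hyo (Sum.inr ⟨a, Finset.mem_Ioi.2 ha⟩)
  have e1 : σ' i ^ 2 ≤ ‖E.starProjection y‖ ^ 2 := by
    calc σ' i ^ 2 = σ' i ^ 2 * ‖y‖ ^ 2 := by rw [hy1]; ring
      _ = ∑ a, σ' i ^ 2 * (inner ℝ (q' a) y : ℝ) ^ 2 := by
        rw [h'.right.norm_sq_eq hy.1, Finset.mul_sum]
      _ ≤ ∑ a, σ' a ^ 2 * (inner ℝ (q' a) y : ℝ) ^ 2 := by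
        refine Finset.sum_le_sum fun a _ => ?_
        rcases le_or_gt a i with ha | ha
        · have := hσ' ha
          have := h'.nonneg i
          gcongr
        · simp [hq' a ha]
      _ = _ := (h'.norm_sq_starProjection_left hy.1).symm
  have e2 : ‖E.starProjection y‖ ^ 2 ≤ σ j ^ 2 := by
    calc _ = ∑ a, σ a ^ 2 * (inner ℝ (q a) y : ℝ) ^ 2 := h.norm_sq_starProjection_left hy.2
      _ ≤ ∑ a, σ j ^ 2 * (inner ℝ (q a) y : ℝ) ^ 2 := by
        refine Finset.sum_le_sum fun a _ => ?_
        rcases lt_or_ge a j with ha | ha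
        · simp [hq a ha]
        · have := hσ ha
          have := h.nonneg a
          gcongr
      _ = σ j ^ 2 * ‖y‖ ^ 2 := by rw [h.right.norm_sq_eq hy.2, Finset.mul_sum]
      _ = _ := by rw [hy1]; ring
  exact le_of_sq_le_sq (e1.trans e2) (h.nonneg j)

/-- Interlacing with `F' = F` and `s = k`, in both directions. -/
theorem eq_of_antitone {p' q' : Fin k → Vec n} {σ' : Fin k → ℝ} (h : Biorthogonal E F p q σ)
    (hσ : Antitone σ) (h' : Biorthogonal E F p' q' σ') (hσ' : Antitone σ') : σ = σ' := by
  have hk : k ≤ Module.finrank ℝ ↥(F ⊓ F) := by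
    rw [inf_idem, h.right.finrank_eq, Fintype.card_fin]
  funext i
  exact le_antisymm (h'.le_of_finrank_inf hσ' h hσ hk le_rfl)
    (h.le_of_finrank_inf hσ h' hσ' hk le_rfl)

end Biorthogonal

/-! ### Principal vectors as a singular value decomposition -/

theorem IsPrincipalVectors.symm {n m : ℕ} {E F : Submodule ℝ (Vec n)} {p q : Fin m → Vec n}
    (h : IsPrincipalVectors E F p q) : IsPrincipalVectors F E q p := fun i =>
  ⟨(h i).1.symm, fun x y hxy => by
    rw [real_inner_comm y x, real_inner_comm (p i) (q i)]; exact (h i).2 y x hxy.symm⟩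

theorem IsPrincipalVectors.inner_nonneg {n m : ℕ} {E F : Submodule ℝ (Vec n)}
    {p q : Fin m → Vec n} (h : IsPrincipalVectors E F p q) (i : Fin m) :
    0 ≤ (inner ℝ (p i) (q i) : ℝ) := by
  obtain ⟨⟨⟨h1, h2, h3⟩, h4⟩, h5⟩ := h i
  have := h5 (-p i) (q i) ⟨⟨E.neg_mem h1, by rwa [norm_neg],
    fun j hj => by rw [inner_neg_left, h3 j hj, neg_zero]⟩, h4⟩
  rw [inner_neg_left] at this
  linarith

/-- If `c = ⟨p j, q i⟩` were not zero, tilting `p i` towards `p j` would improve step `i`: the unit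
vector along `σ • p i + c • p j` is still feasible there, and its scalar product with `q i` is `√(σ²
+ c²) > σ`. -/
theorem IsPrincipalVectors.inner_eq_zero_of_lt {n m : ℕ} {E F : Submodule ℝ (Vec n)}
    {p q : Fin m → Vec n} (h : IsPrincipalVectors E F p q) {i j : Fin m} (hij : i < j) :
    (inner ℝ (p j) (q i) : ℝ) = 0 := by
  obtain ⟨⟨⟨h1, h2, h3⟩, h4⟩, h5⟩ := h i
  obtain ⟨⟨⟨h1', h2', h3'⟩, -⟩, -⟩ := h j
  have hσ := h.inner_nonneg i
  set σ := (inner ℝ (p i) (q i) : ℝ)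
  set c := (inner ℝ (p j) (q i) : ℝ)
  by_contra hc0
  have hpos : 0 < σ ^ 2 + c ^ 2 := by positivity
  set ρ := √(σ ^ 2 + c ^ 2)
  have hρ : 0 < ρ := Real.sqrt_pos.2 hpos
  have hρ2 : ρ ^ 2 = σ ^ 2 + c ^ 2 := Real.sq_sqrt hpos.le
  have key := h5 ((σ / ρ) • p i + (c / ρ) • p j) (q i) ⟨⟨E.add_mem (E.smul_mem _ h1)
    (E.smul_mem _ h1'), ?_, fun a ha => ?_⟩, h4⟩
  · rw [inner_add_left, real_inner_smul_left, real_inner_smul_left] at key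
    have e : σ / ρ * σ + c / ρ * c = ρ := by
      field_simp
      linarith
    have key' : ρ ≤ σ := by rw [← e]; exact key
    have : 0 < c ^ 2 := by positivity
    nlinarith
  · have h0 : (inner ℝ (p i) (p j) : ℝ) = 0 := by rw [real_inner_comm]; exact h3' i hij
    have : ‖(σ / ρ) • p i + (c / ρ) • p j‖ ^ 2 = 1 := by
      rw [norm_add_sq_real, norm_smul, norm_smul, h2, h2', real_inner_smul_left,
        real_inner_smul_right, h0]
      simp only [mul_one, mul_zero, add_zero, Real.norm_eq_abs, sq_abs, div_pow]
      rw [← add_div, hρ2, div_self hpos.ne']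
    exact (pow_eq_one_iff_of_nonneg (norm_nonneg _) two_ne_zero).1 this
  · rw [inner_add_left, real_inner_smul_left, real_inner_smul_left, h3 a ha,
      h3' a (ha.trans hij)]
    simp

theorem IsPrincipalVectors.orthonormal_left {n m : ℕ} {E F : Submodule ℝ (Vec n)}
    {p q : Fin m → Vec n} (h : IsPrincipalVectors E F p q) : Orthonormal ℝ p := by
  refine ⟨fun i => (h i).1.1.2.1, fun i j hij => ?_⟩
  rcases lt_or_gt_of_ne hij with hlt | hlt
  · rw [real_inner_comm]; exact (h j).1.1.2.2 i hlt
  · exact (h i).1.1.2.2 j hlt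

theorem IsPrincipalVectors.biorthogonal {n k : ℕ} {E F : Submodule ℝ (Vec n)}
    {p q : Fin k → Vec n} (h : IsPrincipalVectors E F p q) (hE : Module.finrank ℝ E = k)
    (hF : Module.finrank ℝ F = k) :
    Biorthogonal E F p q (fun i => inner ℝ (p i) (q i)) where
  left := .of_finrank h.orthonormal_left (fun i => (h i).1.1.1) (by simpa using hE)
  right := .of_finrank h.symm.orthonormal_left (fun i => (h i).1.2.1) (by simpa using hF)
  inner_eq i j := by
    split_ifs with hij
    · rw [hij]
    · rcases lt_or_gt_of_ne hij with hlt | hlt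
      · rw [real_inner_comm]; exact h.symm.inner_eq_zero_of_lt hlt
      · exact h.inner_eq_zero_of_lt hlt
  nonneg := h.inner_nonneg

theorem IsPrincipalVectors.antitone {n m : ℕ} {E F : Submodule ℝ (Vec n)}
    {p q : Fin m → Vec n} (h : IsPrincipalVectors E F p q) :
    Antitone (fun i => (inner ℝ (p i) (q i) : ℝ)) := by
  intro i j hij
  obtain ⟨⟨h1, h2, h3⟩, h4, h5, h6⟩ := (h j).1
  exact (h i).2 _ _ ⟨⟨h1, h2, fun a ha => h3 a (ha.trans_le hij)⟩, h4, h5,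
    fun a ha => h6 a (ha.trans_le hij)⟩

theorem principalAngle_mem {k n : ℕ} (E F : Gr k n) (i : Fin k) :
    principalAngle E F i ∈ Set.Icc 0 (Real.pi / 2) := by
  exact ⟨Real.arccos_nonneg _, Real.arccos_le_pi_div_two.2
    (IsPrincipalVectors.inner_nonneg (exists_isPrincipalVectors E.plane F.plane k E.finrank_eq.ge
      F.finrank_eq.ge).choose_spec.choose_spec i)⟩

theorem exists_biorthogonal {k n : ℕ} (E F : Gr k n) : ∃ p q : Fin k → Vec n,
    Biorthogonal E.plane F.plane p q (fun i => Real.cos (principalAngle E F i)) := by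
  have h := (exists_isPrincipalVectors E.plane F.plane k E.finrank_eq.ge
    F.finrank_eq.ge).choose_spec.choose_spec
  have hb := h.biorthogonal E.finrank_eq F.finrank_eq
  have e : (fun i => Real.cos (principalAngle E F i)) = _ := funext fun i =>
    Real.cos_arccos (by linarith [hb.nonneg i]) (hb.le_one i)
  exact ⟨_, _, e ▸ hb⟩

theorem monotone_principalAngle {k n : ℕ} (E F : Gr k n) : Monotone (principalAngle E F) := by
  intro i j hij
  have h := (exists_isPrincipalVectors E.plane F.plane k E.finrank_eq.ge
    F.finrank_eq.ge).choose_spec.choose_spec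
  exact Real.antitone_arccos (h.antitone hij)

theorem antitone_cos_principalAngle {k n : ℕ} (E F : Gr k n) :
    Antitone (fun i => Real.cos (principalAngle E F i)) := by
  intro i j hij
  exact Real.cos_le_cos_of_nonneg_of_le_pi (principalAngle_mem E F i).1
    (by linarith [(principalAngle_mem E F j).2, Real.pi_pos]) (monotone_principalAngle E F hij)

/-- Frees the angles from the choice of principal vectors in their definition: any sorted
biorthogonal pair computes them. -/
theorem Biorthogonal.principalAngle_eq {k n : ℕ} {E F : Gr k n} {p q : Fin k → Vec n}
    {σ : Fin k → ℝ} (h : Biorthogonal E.plane F.plane p q σ) (hσ : Antitone σ) (i : Fin k) :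
    principalAngle E F i = Real.arccos (σ i) := by
  obtain ⟨p', q', h'⟩ := exists_biorthogonal E F
  have := congrFun (h.eq_of_antitone hσ h' (antitone_cos_principalAngle E F)) i
  rw [this, Real.arccos_cos (principalAngle_mem E F i).1
    (by linarith [(principalAngle_mem E F i).2, Real.pi_pos])]

theorem IsPrincipalVectors.biorthogonal_cos {k n : ℕ} {E F : Gr k n} {p q : Fin k → Vec n}
    (h : IsPrincipalVectors E.plane F.plane p q) :
    Biorthogonal E.plane F.plane p q (fun i => Real.cos (principalAngle E F i)) := by
  have hb := h.biorthogonal E.finrank_eq F.finrank_eq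
  convert hb using 2 with i
  rw [hb.principalAngle_eq h.antitone,
    Real.cos_arccos (by linarith [hb.nonneg i]) (hb.le_one i)]

/-- No order on `σ` is needed, since the sum is symmetric. This matters for `E_m`, whose natural
bases give `cos θ₁, …, cos θ_s, 1, …, 1`. -/
theorem Biorthogonal.grassmannDist_eq {k n : ℕ} {E F : Gr k n} {p q : Fin k → Vec n}
    {σ : Fin k → ℝ} (h : Biorthogonal E.plane F.plane p q σ) :
    grassmannDist E F = √(∑ i, Real.arccos (σ i) ^ 2) := by
  let e := Tuple.sort (fun i => -σ i)
  have hanti : Antitone (σ ∘ e) := fun i j hij => by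
    have := Tuple.monotone_sort (fun i => -σ i) hij
    simpa using this
  rw [grassmannDist]
  simp_rw [(h.comp_perm e).principalAngle_eq hanti]
  congr 1
  exact Equiv.sum_comp e (fun i => Real.arccos (σ i) ^ 2)

end NonlinearEckartYoung

namespace NonlinearEckartYoung

/-! ### Minimizing the distance on the Schubert variety -/

theorem card_filter_val_lt {k s : ℕ} (hs : s ≤ k) :
    (Finset.univ.filter fun i : Fin k => (i : ℕ) < s).card = s := by
  rw [Fin.card_filter_val_lt, min_eq_right hs]

/-- A strictly monotone sequence has a strict threshold after `s` terms. -/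
theorem exists_threshold {k s : ℕ} (hs : 1 ≤ s) (hsk : s ≤ k) {a : Fin k → ℝ}
    (ha : StrictMono a) : ∃ c, ∀ i : Fin k, ((i : ℕ) < s → a i < c) ∧ (s ≤ i → c < a i) := by
  rcases hsk.eq_or_lt with rfl | hlt
  · refine ⟨a ⟨s - 1, by omega⟩ + 1, fun i => ⟨fun _ => ?_, fun h => absurd i.2 (by omega)⟩⟩
    have : a i ≤ a ⟨s - 1, by omega⟩ := ha.monotone (Fin.le_def.2 (by simp; omega))
    linarith
  · have h0 : a ⟨s - 1, by omega⟩ < a ⟨s, hlt⟩ := ha (Fin.lt_def.2 (by simp; omega))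
    refine ⟨(a ⟨s - 1, by omega⟩ + a ⟨s, hlt⟩) / 2, fun i => ⟨fun h => ?_, fun h => ?_⟩⟩
    · have : a i ≤ a ⟨s - 1, by omega⟩ := ha.monotone (Fin.le_def.2 (by simp; omega))
      linarith
    · have : a ⟨s, hlt⟩ ≤ a i := ha.monotone (Fin.le_def.2 h)
      linarith

/-- A weighted sum of a strictly increasing sequence, with weights in `[0, 1]` of total `s`, is at
least the sum of the first `s` terms, with equality only for the obvious weights. -/
theorem sum_filter_lt_le_sum_mul {k s : ℕ} (hs : 1 ≤ s) (hsk : s ≤ k) {a t : Fin k → ℝ}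
    (ha : StrictMono a) (h0 : ∀ i, 0 ≤ t i) (h1 : ∀ i, t i ≤ 1) (ht : ∑ i, t i = s) :
    ∑ i with (i : Fin k).val < s, a i ≤ ∑ i, a i * t i ∧
      (∑ i, a i * t i ≤ ∑ i with (i : Fin k).val < s, a i →
        ∀ i : Fin k, t i = if (i : ℕ) < s then 1 else 0) := by
  obtain ⟨c, hc⟩ := exists_threshold hs hsk ha
  -- Since the weights and the indicator of `i < s` have the same total, subtracting the threshold
  -- `c` does not change the difference of the two sums, and every term becomes nonnegative.
  -- Equality kills each term, and `a i ≠ c` then fixes `t i`.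
  have hnn : ∀ i ∈ Finset.univ, 0 ≤ (a i - c) * (t i - if (i : ℕ) < s then 1 else 0) := by
    intro i _
    split_ifs with hi
    · exact mul_nonneg_of_nonpos_of_nonpos (by linarith [(hc i).1 hi]) (by linarith [h1 i])
    · exact mul_nonneg (by linarith [(hc i).2 (by omega)]) (by linarith [h0 i])
  have hsum : ∑ i, (a i - c) * (t i - if (i : ℕ) < s then 1 else 0) =
      ∑ i, a i * t i - ∑ i with (i : Fin k).val < s, a i := by
    have e1 : ∑ i : Fin k, (if (i : ℕ) < s then (1 : ℝ) else 0) = s := by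
      rw [Finset.sum_boole, card_filter_val_lt hsk]
    have e2 : ∀ i, (a i - c) * (t i - if (i : ℕ) < s then 1 else 0) =
        a i * t i - (if (i : ℕ) < s then a i else 0) -
          c * (t i - if (i : ℕ) < s then 1 else 0) := by
      intro i; split_ifs <;> ring
    simp_rw [e2]
    rw [Finset.sum_sub_distrib, Finset.sum_sub_distrib, ← Finset.mul_sum, Finset.sum_sub_distrib,
      e1, ht, Finset.sum_filter]
    ring
  refine ⟨by linarith [Finset.sum_nonneg hnn], fun hle i => ?_⟩
  have hz := (Finset.sum_eq_zero_iff_of_nonneg hnn).1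
    (le_antisymm (by linarith) (Finset.sum_nonneg hnn)) i (Finset.mem_univ i)
  have hne : a i - c ≠ 0 := by
    rcases lt_or_ge (i : ℕ) s with hi | hi
    · exact (sub_neg.2 ((hc i).1 hi)).ne
    · exact (sub_pos.2 ((hc i).2 hi)).ne'
  have := (mul_eq_zero.1 hz).resolve_left hne
  linarith

/-- The total weight of the first `s` vectors of an orthonormal basis on another one, when these
lie in the span of the latter. -/
theorem sum_sum_inner_sq {n k s : ℕ} {U W : Submodule ℝ (Vec n)} {b q : Fin k → Vec n}
    (hb : IsONSpan U b) (hq : IsONSpan W q) (hsk : s ≤ k)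
    (hbW : ∀ i : Fin k, (i : ℕ) < s → b i ∈ W) :
    ∑ j, ∑ i with (i : Fin k).val < s, (inner ℝ (q j) (b i) : ℝ) ^ 2 = s := by
  rw [Finset.sum_comm]
  have : ∀ i ∈ Finset.univ.filter (fun i : Fin k => (i : ℕ) < s),
      ∑ j, (inner ℝ (q j) (b i) : ℝ) ^ 2 = 1 := by
    intro i hi
    rw [← hq.norm_sq_eq (hbW i (Finset.mem_filter.1 hi).2), hb.norm_eq, one_pow]
  rw [Finset.sum_congr rfl this, Finset.sum_const, card_filter_val_lt hsk, nsmul_one]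

theorem sum_inner_sq_le_one {n k : ℕ} {U W : Submodule ℝ (Vec n)} {b q : Fin k → Vec n}
    (hb : IsONSpan U b) (hq : IsONSpan W q) (S : Finset (Fin k)) (j : Fin k) :
    ∑ i ∈ S, (inner ℝ (q j) (b i) : ℝ) ^ 2 ≤ 1 := by
  have := hb.orthonormal.sum_inner_products_le (q j) (s := S)
  rw [hq.norm_eq, one_pow] at this
  refine le_trans (le_of_eq ?_) this
  refine Finset.sum_congr rfl fun i _ => ?_
  rw [Real.norm_eq_abs, sq_abs, real_inner_comm]

/-- Shift a sequence by `k - s` places, and fill up with `c`. -/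
theorem sum_shift {k s : ℕ} (hsk : s ≤ k) (g : Fin k → ℝ) (c : ℝ) :
    (∑ i : Fin k, if h : k - s ≤ (i : ℕ) then g ⟨i - (k - s), by omega⟩ else c) =
      ((k - s : ℕ) : ℝ) * c + ∑ j with (j : Fin k).val < s, g j := by
  obtain ⟨r, rfl⟩ := Nat.exists_eq_add_of_le' hsk
  rw [Fin.sum_univ_add]
  have e1 : ∀ i : Fin r, ¬ (r + s - s ≤ ((Fin.castAdd s i : Fin (r + s)) : ℕ)) := by
    intro i; simp
  congr 1
  · rw [Finset.sum_congr rfl fun i _ => dif_neg (e1 i)]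
    simp
  · refine Finset.sum_bij (fun i _ => (⟨i, by omega⟩ : Fin (r + s))) ?_ ?_ ?_ ?_
    · intro i _; simp
    · intro i _ j _ h; simpa [Fin.ext_iff] using h
    · intro j hj
      exact ⟨⟨j, (Finset.mem_filter.1 hj).2⟩, Finset.mem_univ _, rfl⟩
    · intro i _
      simp

/-- The angles between `L` and a plane of `Ω_s` are bounded below by `0, …, 0, θ₁, …, θ_s`, where
`θ` are the angles between `L` and `W`. -/
theorem shifted_principalAngle_le {k n s : ℕ} {L W E : Gr k n} (hE : E ∈ schubert W s)
    (hsk : s ≤ k) (i : Fin k) :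
    (if h : k - s ≤ (i : ℕ) then principalAngle L W ⟨i - (k - s), by omega⟩ else 0) ≤
      principalAngle L E i := by
  obtain ⟨p, q, h⟩ := exists_biorthogonal L W
  obtain ⟨p', q', h'⟩ := exists_biorthogonal L E
  split_ifs with hi
  -- With `j = i - (k - s)` the index condition of interlacing is an equality.
  · have := h.le_of_finrank_inf (antitone_cos_principalAngle L W) h'
      (antitone_cos_principalAngle L E) hE (i := i) (j := ⟨i - (k - s), by omega⟩)
      (by simp; omega)
    have m1 := principalAngle_mem L W ⟨i - (k - s), by omega⟩
    have m2 := principalAngle_mem L E i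
    have hpi := Real.pi_pos
    exact (Real.strictAntiOn_cos.le_iff_ge ⟨m2.1, by linarith [m2.2]⟩
      ⟨m1.1, by linarith [m1.2]⟩).1 this
  · exact (principalAngle_mem L E i).1

theorem sum_shifted_sq {k n s : ℕ} (L W : Gr k n) (hsk : s ≤ k) :
    ∑ i : Fin k, (if h : k - s ≤ (i : ℕ) then
      principalAngle L W ⟨i - (k - s), by omega⟩ else 0) ^ 2 =
      ∑ j with (j : Fin k).val < s, principalAngle L W j ^ 2 := by
  have := sum_shift hsk (fun i => principalAngle L W i ^ 2) 0
  rw [mul_zero, zero_add] at this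
  rw [← this]
  refine Finset.sum_congr rfl fun i _ => ?_
  split_ifs <;> simp

/-- The termwise bounds by the shifted angles must all be equalities, so the angles between `L` and
`E` are `k - s` zeros followed by `θ₁, …, θ_s`. The sum of squared cosines is `tr(P_L P_E)`. -/
theorem sum_cos_sq_of_sum_le {k n s : ℕ} {L W E : Gr k n} (hE : E ∈ schubert W s)
    (hsk : s ≤ k) (hle : ∑ i, principalAngle L E i ^ 2 ≤
      ∑ j with (j : Fin k).val < s, principalAngle L W j ^ 2) :
    ∑ i, Real.cos (principalAngle L E i) ^ 2 =
      ((k - s : ℕ) : ℝ) + ∑ j with (j : Fin k).val < s, Real.cos (principalAngle L W j) ^ 2 := by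
  have hnn : ∀ i : Fin k, 0 ≤ (if h : k - s ≤ (i : ℕ) then
      principalAngle L W ⟨i - (k - s), by omega⟩ else 0) := by
    intro i
    split_ifs
    · exact (principalAngle_mem L W _).1
    · exact le_rfl
  rw [← sum_shifted_sq L W hsk] at hle
  have heq := (Finset.sum_eq_sum_iff_of_le fun i _ => pow_le_pow_left₀ (hnn i)
    (shifted_principalAngle_le hE hsk i) 2).1 (le_antisymm (Finset.sum_le_sum fun i _ =>
      pow_le_pow_left₀ (hnn i) (shifted_principalAngle_le hE hsk i) 2) hle)
  have h2 := sum_shift hsk (fun i => Real.cos (principalAngle L W i) ^ 2) 1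
  rw [mul_one] at h2
  rw [← h2]
  refine Finset.sum_congr rfl fun i hi => ?_
  have h3 := (pow_left_inj₀ (hnn i) (principalAngle_mem L E i).1 two_ne_zero).1 (heq i hi)
  rw [← h3]
  split_ifs <;> simp

/-- A plane of `Ω_s` at distance at most `(θ₁² + ⋯ + θ_s²)^{1/2}` from `L` is contained in the
Eckart-Young plane. -/
theorem plane_le_of_sum_le {k n s : ℕ} {L W E : Gr k n} (hs : 1 ≤ s) (hsk : s ≤ k)
    (hLW : HasDistinctAngles L W) {p q : Fin k → Vec n}
    (h : Biorthogonal L.plane W.plane p q (fun i => Real.cos (principalAngle L W i)))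
    (hE : E ∈ schubert W s) (hle : ∑ i, principalAngle L E i ^ 2 ≤
      ∑ j with (j : Fin k).val < s, principalAngle L W j ^ 2) :
    E.plane ≤ Submodule.span ℝ
      (Set.range fun i : Fin k => if (i : ℕ) < s then q i else p i) := by
  obtain ⟨hpos, hmono, hlt⟩ := hLW
  have hpi := Real.pi_pos
  set σ : Fin k → ℝ := fun i => Real.cos (principalAngle L W i)
  have hσpos : ∀ i, 0 < σ i := fun i =>
    Real.cos_pos_of_mem_Ioo ⟨by linarith [hpos i], hlt i⟩
  have hσanti : StrictAnti σ := fun i j hij => Real.strictAntiOn_cos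
    ⟨(hpos i).le, by linarith [hlt i]⟩ ⟨(hpos j).le, by linarith [hlt j]⟩ (hmono hij)
  obtain ⟨b, hb, hbN⟩ := exists_isONSpan_of_le (inf_le_left : E.plane ⊓ W.plane ≤ E.plane)
    E.finrank_eq hE
  obtain ⟨p', q', h'⟩ := exists_biorthogonal L E
  -- The trace `tr(P_L P_E)`, known from the angles, evaluated in the basis `b` adapted to `E ⊓ W`.
  have htot : ∑ i, ‖L.plane.starProjection (b i)‖ ^ 2 =
      ((k - s : ℕ) : ℝ) + ∑ j with (j : Fin k).val < s, σ j ^ 2 := by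
    rw [← sum_cos_sq_of_sum_le hE hsk hle, h'.left.sum_norm_sq_starProjection_comm hb]
    refine Finset.sum_congr rfl fun i _ => ?_
    rw [h'.starProjection_right, norm_smul, h'.right.norm_eq, mul_one, Real.norm_eq_abs, sq_abs]
  -- The weight of `q j` on the first `s` vectors of `b`: at most `1` by Bessel, with total `s`. The
  -- lemma on weighted sums is applied to `-σ²`, because here a sum is bounded from above.
  let t : Fin k → ℝ := fun j => ∑ i with (i : Fin k).val < s, (inner ℝ (q j) (b i) : ℝ) ^ 2
  have ht := sum_filter_lt_le_sum_mul hs hsk (a := fun j => -σ j ^ 2) (t := t)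
    (fun i j hij => neg_lt_neg (pow_lt_pow_left₀ (hσanti hij) (hσpos j).le two_ne_zero))
    (fun j => Finset.sum_nonneg fun i _ => sq_nonneg _)
    (fun j => sum_inner_sq_le_one hb h.right _ j)
    (sum_sum_inner_sq hb h.right hsk fun i hi => (hbN i hi).2)
  have hfirst : ∑ i with (i : Fin k).val < s, ‖L.plane.starProjection (b i)‖ ^ 2 =
      ∑ j, σ j ^ 2 * t j := by
    simp only [t, Finset.mul_sum]
    rw [Finset.sum_comm]
    refine Finset.sum_congr rfl fun i hi => ?_
    rw [h.norm_sq_starProjection_left (hbN i (Finset.mem_filter.1 hi).2).2]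
  have hle1 : ∀ i, ‖L.plane.starProjection (b i)‖ ^ 2 ≤ 1 := fun i => by
    have := L.plane.norm_starProjection_apply_le (b i)
    rw [hb.norm_eq] at this
    exact pow_le_one₀ (norm_nonneg _) this
  have hcard : (Finset.univ.filter fun i : Fin k => ¬ (i : ℕ) < s).card = k - s := by
    rw [← Finset.compl_filter, Finset.card_compl, Fintype.card_fin, card_filter_val_lt hsk]
  have hsecond_le : ∑ i with ¬ (i : Fin k).val < s, ‖L.plane.starProjection (b i)‖ ^ 2 ≤
      ∑ i with ¬ (i : Fin k).val < s, (1 : ℝ) := Finset.sum_le_sum fun i _ => hle1 i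
  have hsplit := Finset.sum_filter_add_sum_filter_not Finset.univ (fun i : Fin k => (i : ℕ) < s)
    (fun i => ‖L.plane.starProjection (b i)‖ ^ 2)
  have hone : ∑ i with ¬ (i : Fin k).val < s, (1 : ℝ) = ((k - s : ℕ) : ℝ) := by
    rw [Finset.sum_const, hcard, nsmul_one]
  simp only [neg_mul, Finset.sum_neg_distrib, neg_le_neg_iff] at ht
  -- The first `s` terms of the trace contribute at most `∑ σ j ^ 2` over `j < s` and the others at
  -- most `k - s`. The total equals the sum of these bounds, so both are attained.
  have hteq := ht.2 (by linarith)
  have heq2 := (Finset.sum_eq_sum_iff_of_le fun i _ => hle1 i).1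
    (le_antisymm hsecond_le (by linarith [ht.1]))
  have hin : ∀ i : Fin k, ¬ (i : ℕ) < s → b i ∈ L.plane := by
    intro i hi
    have h1 := heq2 i (by simpa using hi)
    rw [Submodule.mem_iff_norm_starProjection, hb.norm_eq]
    exact (pow_eq_one_iff_of_nonneg (norm_nonneg _) two_ne_zero).1 h1
  have hqb : ∀ j i : Fin k, ¬ (j : ℕ) < s → (i : ℕ) < s → (inner ℝ (q j) (b i) : ℝ) = 0 := by
    intro j i hj hi
    have h1 := hteq j
    rw [if_neg hj] at h1
    have := (Finset.sum_eq_zero_iff_of_nonneg fun i _ => sq_nonneg _).1 h1 i (by simpa using hi)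
    exact pow_eq_zero_iff two_ne_zero |>.1 this
  have hqb' : ∀ j i : Fin k, (j : ℕ) < s → ¬ (i : ℕ) < s → (inner ℝ (q j) (b i) : ℝ) = 0 := by
    intro j i hj hi
    have h1 := hteq j
    rw [if_pos hj] at h1
    -- For `j < s` the first vectors of `b` already use up all of `‖q j‖² = 1`, which leaves nothing
    -- for the others.
    have h2 := sum_inner_sq_le_one hb h.right Finset.univ j
    rw [← Finset.sum_filter_add_sum_filter_not Finset.univ (fun i : Fin k => (i : ℕ) < s)] at h2
    have h3 : 0 ≤ ∑ i with ¬ (i : Fin k).val < s, (inner ℝ (q j) (b i) : ℝ) ^ 2 :=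
      Finset.sum_nonneg fun i _ => sq_nonneg _
    have := (Finset.sum_eq_zero_iff_of_nonneg fun i _ => sq_nonneg _).1
      (le_antisymm (by simp only [t] at h1; linarith) h3) i (by simpa using hi)
    exact pow_eq_zero_iff two_ne_zero |>.1 this
  rw [← hb.span_eq, Submodule.span_le]
  rintro _ ⟨i, rfl⟩
  by_cases hi : (i : ℕ) < s
  · rw [h.right.eq_sum (hbN i hi).2]
    refine Submodule.sum_mem _ fun j _ => ?_
    by_cases hj : (j : ℕ) < s
    · exact Submodule.smul_mem _ _ (Submodule.subset_span ⟨j, if_pos hj⟩)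
    · rw [hqb j i hj hi, zero_smul]
      exact Submodule.zero_mem _
  · rw [h.left.eq_sum (hin i hi)]
    refine Submodule.sum_mem _ fun j _ => ?_
    by_cases hj : (j : ℕ) < s
    -- On `L`, pairing with `q j` is `σ j` times pairing with `p j`. Here `θ j < π / 2` is
    -- essential: `σ j ≠ 0` lets orthogonality pass from `q j` to `p j`.
    · have h1 := h.symm.inner_left (hin i hi) j
      rw [hqb' j i hj hi] at h1
      rw [(mul_eq_zero.1 h1.symm).resolve_left (hσpos j).ne', zero_smul]
      exact Submodule.zero_mem _
    · exact Submodule.smul_mem _ _ (Submodule.subset_span ⟨j, if_neg hj⟩)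

/-- The first vectors of `q` followed by the last vectors of `p` are biorthogonal to `p`. -/
theorem Biorthogonal.mixed {n k : ℕ} {E F U : Submodule ℝ (Vec n)} {p q : Fin k → Vec n}
    {σ : Fin k → ℝ} (h : Biorthogonal E F p q σ) (s : ℕ)
    (hU : U = Submodule.span ℝ (Set.range fun i : Fin k => if (i : ℕ) < s then q i else p i)) :
    Biorthogonal E U p (fun i => if (i : ℕ) < s then q i else p i)
      (fun i => if (i : ℕ) < s then σ i else 1) where
  left := h.left
  right := by
    refine ⟨orthonormal_iff_ite.2 fun i j => ?_, hU.symm⟩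
    by_cases hi : (i : ℕ) < s <;> by_cases hj : (j : ℕ) < s
    · simp [hi, hj, h.right.inner_eq]
    · have : i ≠ j := by rintro rfl; exact hj hi
      simp [hi, hj, h.symm.inner_eq, this]
    · have : i ≠ j := by rintro rfl; exact hi hj
      simp [hi, hj, h.inner_eq, this]
    · simp [hi, hj, h.left.inner_eq]
  inner_eq i j := by
    by_cases hj : (j : ℕ) < s
    · simp only [hj, if_true, h.inner_eq]
      by_cases hij : i = j
      · simp [hij, hj]
      · simp [hij]
    · simp only [hj, if_false, h.left.inner_eq]
      by_cases hij : i = j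
      · simp [hij, hj]
      · simp [hij]
  nonneg i := by
    split_ifs
    · exact h.nonneg i
    · exact zero_le_one

theorem grassmannDist_mixed {k n s : ℕ} {L W Em : Gr k n} {p q : Fin k → Vec n}
    (h : Biorthogonal L.plane W.plane p q (fun i => Real.cos (principalAngle L W i)))
    (hEm : Em.plane = Submodule.span ℝ
      (Set.range fun i : Fin k => if (i : ℕ) < s then q i else p i)) :
    grassmannDist L Em = √(∑ j with (j : Fin k).val < s, principalAngle L W j ^ 2) := by
  rw [(h.mixed s hEm).grassmannDist_eq, Finset.sum_filter]
  congr 1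
  refine Finset.sum_congr rfl fun i _ => ?_
  split_ifs
  · rw [Real.arccos_cos (principalAngle_mem L W i).1
      (by linarith [(principalAngle_mem L W i).2, Real.pi_pos])]
  · simp

theorem mem_schubert_mixed {k n s : ℕ} {W Em : Gr k n} (hsk : s ≤ k) {p q : Fin k → Vec n}
    (hq : IsONSpan W.plane q) (hEm : Em.plane = Submodule.span ℝ
      (Set.range fun i : Fin k => if (i : ℕ) < s then q i else p i)) :
    Em ∈ schubert W s := by
  have hv := hq.orthonormal.comp (Fin.castLE hsk) (Fin.castLE_injective hsk)
  have := finrank_span_eq_card hv.linearIndependent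
  rw [Fintype.card_fin] at this
  change s ≤ Module.finrank ℝ ↥(Em.plane ⊓ W.plane)
  rw [← this]
  refine Submodule.finrank_mono ?_
  rw [Submodule.span_le]
  rintro _ ⟨i, rfl⟩
  refine ⟨?_, hq.mem _⟩
  rw [hEm]
  exact Submodule.subset_span ⟨Fin.castLE hsk i, if_pos i.2⟩

theorem grassmannDist_mixed_lt {k n s : ℕ} {L W Em E : Gr k n} (hs : 1 ≤ s) (hsk : s ≤ k)
    (hLW : HasDistinctAngles L W) {p q : Fin k → Vec n}
    (h : Biorthogonal L.plane W.plane p q (fun i => Real.cos (principalAngle L W i)))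
    (hEm : Em.plane = Submodule.span ℝ
      (Set.range fun i : Fin k => if (i : ℕ) < s then q i else p i))
    (hE : E ∈ schubert W s) (hne : E ≠ Em) : grassmannDist L Em < grassmannDist L E := by
  by_contra hcon
  rw [grassmannDist_mixed h hEm, grassmannDist, not_lt,
    Real.sqrt_le_sqrt_iff (Finset.sum_nonneg fun i _ => sq_nonneg _)] at hcon
  have := plane_le_of_sum_le hs hsk hLW h hE hcon
  rw [← hEm] at this
  exact hne (Gr.ext (Submodule.eq_of_le_of_finrank_eq this (by rw [E.finrank_eq, Em.finrank_eq])))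

end NonlinearEckartYoung

namespace NonlinearEckartYoung

/-! ### The exponential map in normal form -/

/-- If `φ : ℂ → ℝⁿ` intertwines multiplication by `w` and `M`, then it intertwines their
exponentials. -/
theorem exp_apply_intertwine {n : ℕ} (M : Vec n →L[ℝ] Vec n) (w : ℂ) (φ : ℂ →L[ℝ] Vec n)
    (h : ∀ z, M (φ z) = φ (w * z)) (z : ℂ) :
    (NormedSpace.exp M : Vec n →L[ℝ] Vec n) (φ z) = φ (Complex.exp w * z) := by
  have hpow : ∀ m : ℕ, (M ^ m) (φ z) = φ (w ^ m * z) := by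
    intro m
    induction m with
    | zero => simp
    | succ m ih =>
      rw [pow_succ', pow_succ', mul_assoc, ← h, ← ih]
      rfl
  let _ : NormedAlgebra ℚ (Vec n →L[ℝ] Vec n) := NormedAlgebra.restrictScalars ℚ ℝ _
  have h1 := (NormedSpace.exp_series_hasSum_exp' (𝕂 := ℝ) M).mapL
    (ContinuousLinearMap.apply ℝ (Vec n) (φ z))
  have h2 := ((NormedSpace.exp_series_hasSum_exp' (𝕂 := ℝ) w).mul_right z).mapL φ
  rw [Complex.exp_eq_exp_ℂ]
  refine h1.unique ?_
  have hterm : (fun m : ℕ => ContinuousLinearMap.apply ℝ (Vec n) (φ z)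
      ((m.factorial : ℝ)⁻¹ • M ^ m)) = fun m : ℕ => φ ((m.factorial : ℝ)⁻¹ • w ^ m * z) := by
    funext m
    rw [smul_mul_assoc, map_smul, map_smul, ← hpow]
    rfl
  rw [hterm]
  exact h2

theorem submodule_inner_smul_left {n : ℕ} {U : Submodule ℝ (Vec n)} (x y : U) (c : ℝ) :
    (inner ℝ (c • x) y : ℝ) = c * inner ℝ x y :=
  real_inner_smul_left (x : Vec n) y c

theorem submodule_inner_smul_right {n : ℕ} {U : Submodule ℝ (Vec n)} (x y : U) (c : ℝ) :
    (inner ℝ x (c • y) : ℝ) = c * inner ℝ x y :=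
  real_inner_smul_right (x : Vec n) y c

variable {k n : ℕ} {W : Gr k n}

theorem skew_apply_left (A : Tangent W) (x : W.plane) : skew W A x = A x := by
  have h0 : W.planeᗮ.orthogonalProjectionOnto (x : Vec n) = 0 :=
    Submodule.orthogonalProjectionOnto_orthogonal_apply_eq_zero x.2
  simp [skew, h0]

theorem skew_apply_right (A : Tangent W) (u : W.planeᗮ) : skew W A u = -(A.adjoint u : Vec n) := by
  have h0 : W.plane.orthogonalProjectionOnto (u : Vec n) = 0 :=
    Submodule.orthogonalProjectionOnto_apply_of_mem_orthogonal u.2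
  simp [skew, h0]

/-- The map `φ` below sends `1` to `x` and `i` to `u`, and carries multiplication by `θ i` to `M_A`.
The formula is the image of `exp(θ i) = cos θ + i sin θ`. -/
theorem exp_skew_apply {A : Tangent W} {x : W.plane} {u : W.planeᗮ} {θ : ℝ} (hx : A x = θ • u)
    (hu : A.adjoint u = θ • x) :
    (NormedSpace.exp (skew W A) : Vec n →L[ℝ] Vec n) x =
      Real.cos θ • (x : Vec n) + Real.sin θ • (u : Vec n) := by
  let φ : ℂ →L[ℝ] Vec n := Complex.reCLM.smulRight (x : Vec n) + Complex.imCLM.smulRight (u : Vec n)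
  have hφ : ∀ z, φ z = z.re • (x : Vec n) + z.im • (u : Vec n) := fun z => rfl
  have key := exp_apply_intertwine (skew W A) (θ * Complex.I) φ (fun z => by
    rw [hφ, hφ, map_add, map_smul, map_smul, skew_apply_left, skew_apply_right, hx, hu]
    simp only [Submodule.coe_smul, Complex.mul_re, Complex.mul_im, Complex.ofReal_re,
      Complex.ofReal_im, Complex.I_re, Complex.I_im]
    module) 1
  rw [hφ, hφ, mul_one, Complex.exp_ofReal_mul_I_re, Complex.exp_ofReal_mul_I_im] at key
  simpa using key

/-- `A` is diagonal with respect to the orthonormal basis `b` and the orthogonal family `u`, with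
diagonal entries `τ`; the vectors `u i` with `τ i ≠ 0` have norm one. -/
structure IsDiagonal (A : Tangent W) (b : OrthonormalBasis (Fin k) ℝ W.plane)
    (u : Fin k → W.planeᗮ) (τ : Fin k → ℝ) : Prop where
  apply_basis : ∀ i, A (b i) = τ i • u i
  inner_eq : ∀ i j, τ i * inner ℝ (u i) (u j) = if i = j then τ i else 0

namespace IsDiagonal

variable {A : Tangent W} {b : OrthonormalBasis (Fin k) ℝ W.plane} {u : Fin k → W.planeᗮ}
  {τ : Fin k → ℝ}

theorem adjoint_apply (h : IsDiagonal A b u τ) (i : Fin k) : A.adjoint (u i) = τ i • b i := by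
  have key : ∀ j, (inner ℝ (b j) (A.adjoint (u i)) : ℝ) = if j = i then τ j else 0 := fun j => by
    rw [LinearMap.adjoint_inner_right, h.apply_basis, submodule_inner_smul_left, h.inner_eq]
  rw [← b.sum_repr' (A.adjoint (u i))]
  simp [key]

theorem exp_apply (h : IsDiagonal A b u τ) (i : Fin k) :
    (NormedSpace.exp (skew W A) : Vec n →L[ℝ] Vec n) (b i) =
      Real.cos (τ i) • (b i : Vec n) + Real.sin (τ i) • (u i : Vec n) :=
  exp_skew_apply (h.apply_basis i) (h.adjoint_apply i)

theorem grExp_plane (h : IsDiagonal A b u τ) :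
    (grExp W A).plane = Submodule.span ℝ (Set.range fun i =>
      Real.cos (τ i) • (b i : Vec n) + Real.sin (τ i) • (u i : Vec n)) := by
  have hb := (IsONSpan.of_basis b).span_eq
  change W.plane.map _ = _
  conv_lhs => rw [← hb]
  rw [Submodule.map_span, ← Set.range_comp]
  congr 2
  funext i
  exact h.exp_apply i

/-- The image of the basis `b` under the exponential map is biorthogonal to `b`. -/
theorem biorthogonal (h : IsDiagonal A b u τ) (hτ : ∀ i, τ i ∈ Set.Icc 0 (Real.pi / 2)) :
    Biorthogonal (grExp W A).plane W.plane
      (fun i => Real.cos (τ i) • (b i : Vec n) + Real.sin (τ i) • (u i : Vec n))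
      (fun i => (b i : Vec n)) (fun i => Real.cos (τ i)) where
  left := by
    refine ⟨orthonormal_iff_ite.2 fun i j => ?_, h.grExp_plane.symm⟩
    have h1 : (inner ℝ (b i : Vec n) (u j : Vec n) : ℝ) = 0 := (u j).2 _ (b i).2
    have h2 : (inner ℝ (u i : Vec n) (b j : Vec n) : ℝ) = 0 := by
      rw [real_inner_comm]; exact (u i).2 _ (b j).2
    have h3 : (inner ℝ (b i : Vec n) (b j : Vec n) : ℝ) = if i = j then 1 else 0 :=
      b.inner_eq_ite i j
    -- The `u i` are orthonormal only where `τ i ≠ 0`; elsewhere the factor `sin (τ i)` vanishes.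
    have h4 : Real.sin (τ i) * inner ℝ (u i : Vec n) (u j : Vec n) =
        if i = j then Real.sin (τ i) else 0 := by
      by_cases h0 : τ i = 0
      · simp [h0]
      · have := h.inner_eq i j
        rw [Submodule.coe_inner] at this
        by_cases hij : i = j
        · rw [if_pos hij] at this ⊢
          rw [(mul_eq_left₀ h0).1 this, mul_one]
        · rw [if_neg hij] at this ⊢
          rw [(mul_eq_zero.1 this).resolve_left h0, mul_zero]
    rw [inner_add_left, inner_add_right, inner_add_right]
    simp only [real_inner_smul_left, real_inner_smul_right, h1, h2, h3]
    rw [h4]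
    by_cases hij : i = j
    · subst hij
      simp only [if_true]
      linarith [Real.sin_sq_add_cos_sq (τ i)]
    · simp [hij]
  right := IsONSpan.of_basis b
  inner_eq i j := by
    have h2 : (inner ℝ (u i : Vec n) (b j : Vec n) : ℝ) = 0 := by
      rw [real_inner_comm]; exact (u i).2 _ (b j).2
    have h3 : (inner ℝ (b i : Vec n) (b j : Vec n) : ℝ) = if i = j then 1 else 0 :=
      b.inner_eq_ite i j
    rw [inner_add_left, real_inner_smul_left, real_inner_smul_left, h2, h3]
    simp
  nonneg i := Real.cos_nonneg_of_mem_Icc ⟨by linarith [(hτ i).1, Real.pi_pos], (hτ i).2⟩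

theorem norm_sq_apply (h : IsDiagonal A b u τ) (x : W.plane) :
    ‖A x‖ ^ 2 = ∑ i, τ i ^ 2 * (inner ℝ (b i) x : ℝ) ^ 2 := by
  have e : A.adjoint (A x) = ∑ i, (inner ℝ (b i) x : ℝ) • (τ i ^ 2 • b i) := by
    conv_lhs => rw [← b.sum_repr' x]
    simp [map_sum, h.apply_basis, h.adjoint_apply, smul_smul, sq, mul_assoc]
  rw [← real_inner_self_eq_norm_sq, ← LinearMap.adjoint_inner_right, e, inner_sum]
  refine Finset.sum_congr rfl fun i _ => ?_
  rw [submodule_inner_smul_right, submodule_inner_smul_right, real_inner_comm]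
  ring

/-- There is no need to identify the singular values with the `τ i`: at an eigenvector `x` of `AᵀA`
one has `‖A x‖ = σ ‖x‖`, while `‖A x‖ ≤ c ‖x‖` for every `x`. -/
theorem singularValues_le (h : IsDiagonal A b u τ) {c : ℝ} (hc : 0 ≤ c)
    (hτ : ∀ i, τ i ∈ Set.Icc 0 c) (i : ℕ) : A.singularValues i ≤ c := by
  rcases lt_or_ge i (Module.finrank ℝ W.plane) with hi | hi
  · obtain ⟨x, hx⟩ :=
      (A.hasEigenvalue_adjoint_comp_self_sq_singularValues hi).exists_hasEigenvector
    have hx0 : 0 < ‖x‖ ^ 2 := by have := norm_pos_iff.2 hx.2; positivity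
    have h1 : ‖A x‖ ^ 2 = A.singularValues i ^ 2 * ‖x‖ ^ 2 := by
      have := hx.apply_eq_smul
      rw [LinearMap.comp_apply] at this
      rw [← real_inner_self_eq_norm_sq, ← LinearMap.adjoint_inner_right, this,
        real_inner_smul_right, real_inner_self_eq_norm_sq]
      rfl
    have h2 : ‖A x‖ ^ 2 ≤ c ^ 2 * ‖x‖ ^ 2 := by
      rw [h.norm_sq_apply, ← b.sum_sq_norm_inner_right x, Finset.mul_sum]
      refine Finset.sum_le_sum fun j _ => ?_
      rw [Real.norm_eq_abs, sq_abs]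
      have := (hτ j).1
      have := (hτ j).2
      gcongr
    rw [h1] at h2
    exact le_of_sq_le_sq (le_of_mul_le_mul_right h2 hx0) hc
  · rw [A.singularValues_of_finrank_le hi]
    exact hc

end IsDiagonal

/-- Singular value decomposition of a tangent vector. -/
theorem exists_isDiagonal (A : Tangent W) :
    ∃ b u, IsDiagonal A b u (fun i => A.singularValues i) := by
  let b := A.isSymmetric_adjoint_comp_self.eigenvectorBasis W.finrank_eq
  have hb : ∀ i, A.adjoint (A (b i)) = A.singularValues i ^ 2 • b i := by
    intro i
    have := A.isSymmetric_adjoint_comp_self.apply_eigenvectorBasis W.finrank_eq i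
    rw [A.sq_singularValues_fin W.finrank_eq i]
    exact this
  have hin : ∀ i j, (inner ℝ (A (b i)) (A (b j)) : ℝ) =
      if i = j then A.singularValues i ^ 2 else 0 := by
    intro i j
    rw [← LinearMap.adjoint_inner_left, hb, submodule_inner_smul_left, b.inner_eq_ite]
    simp
  -- For a zero singular value the inverse is `0` by convention, so `u i = 0`, which `IsDiagonal`
  -- allows.
  refine ⟨b, fun i => (A.singularValues i)⁻¹ • A (b i), fun i => ?_, fun i j => ?_⟩
  · by_cases h0 : A.singularValues i = 0
    · have h1 := hin i i
      rw [if_pos rfl, h0, real_inner_self_eq_norm_sq] at h1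
      have h2 : A (b i) = 0 := by simpa using h1
      rw [h2, h0, zero_smul]
    · simp [smul_smul, h0]
  · rw [real_inner_smul_left, real_inner_smul_right, hin]
    by_cases hij : i = j
    · subst hij
      by_cases h0 : A.singularValues i = 0
      · simp [h0]
      · simp only [if_true]
        field_simp
    · simp [hij]

/-- Two tangent vectors in normal form with the same exponential agree. -/
theorem IsDiagonal.eq_of_grExp_eq {A A' : Tangent W} {b b' : OrthonormalBasis (Fin k) ℝ W.plane}
    {u u' : Fin k → W.planeᗮ} {τ τ' : Fin k → ℝ} (h : IsDiagonal A b u τ)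
    (hτ : ∀ i, τ i ∈ Set.Ioo 0 (Real.pi / 2)) (h' : IsDiagonal A' b' u' τ')
    (hτ' : ∀ i, τ' i ∈ Set.Icc 0 (Real.pi / 2)) (he : grExp W A' = grExp W A) : A' = A := by
  have hB := h.biorthogonal fun i => ⟨(hτ i).1.le, (hτ i).2.le⟩
  have hB' := h'.biorthogonal hτ'
  rw [he] at hB'
  set L := (grExp W A).plane
  have hpi := Real.pi_pos
  refine b'.toBasis.ext fun i => ?_
  rw [OrthonormalBasis.coe_toBasis]
  set c : Fin k → ℝ := fun j => inner ℝ (b j) (b' i)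
  have hexp : b' i = ∑ j, c j • b j := (b.sum_repr' (b' i)).symm
  -- Both `b j` and `b' i` are eigenvectors of the compression of `P_L` to `W`, with eigenvalues
  -- `cos² (τ j)` and `cos² (τ' i)`. Vectors that are not orthogonal must have the same eigenvalue.
  have hang : ∀ j, c j ≠ 0 → τ j = τ' i := by
    intro j hj
    have e1 : inner ℝ (b j : Vec n) (W.plane.starProjection (L.starProjection (b' i))) =
        Real.cos (τ' i) ^ 2 * c j := by
      rw [hB'.starProjection_left, map_smul, hB'.starProjection_right, real_inner_smul_right,
        real_inner_smul_right, sq, mul_assoc]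
      rfl
    have e2 : inner ℝ (b j : Vec n) (W.plane.starProjection (L.starProjection (b' i))) =
        Real.cos (τ j) ^ 2 * c j := by
      rw [← Submodule.inner_starProjection_left_eq_right,
        ← Submodule.inner_starProjection_left_eq_right,
        Submodule.starProjection_eq_self_iff.2 (b j).2, hB.starProjection_left,
        real_inner_smul_left, hB.inner_left (b' i).2, sq, mul_assoc]
      rfl
    have e3 := mul_right_cancel₀ hj (e2.symm.trans e1)
    have e4 := (pow_left_inj₀ (hB.nonneg j) (hB'.nonneg i) two_ne_zero).1 e3
    exact Real.injOn_cos ⟨(hτ j).1.le, by linarith [(hτ j).2]⟩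
      ⟨(hτ' i).1, by linarith [(hτ' i).2]⟩ e4
  have hmem : τ' i ∈ Set.Ioo 0 (Real.pi / 2) := by
    by_contra hcon
    have : ∀ j, c j = 0 := fun j => by
      by_contra hj
      exact hcon (hang j hj ▸ hτ j)
    have h1 : b' i = 0 := by rw [hexp]; simp [this]
    have := b'.orthonormal.1 i
    rw [h1, norm_zero] at this
    exact zero_ne_one this
  have hcos : Real.cos (τ' i) ≠ 0 := (Real.cos_pos_of_mem_Ioo ⟨by linarith [hmem.1], hmem.2⟩).ne'
  have hsin : Real.sin (τ' i) ≠ 0 :=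
    (Real.sin_pos_of_pos_of_lt_pi hmem.1 (by linarith [hmem.2])).ne'
  have hbv : (b' i : Vec n) = ∑ j, c j • (b j : Vec n) := by
    have := congrArg Subtype.val hexp
    simpa using this
  -- The projection of `b' i` to `L`, computed in the two normal forms. After cancelling the cosine,
  -- the components in `W` agree, and those in `W^⊥` express `u' i` through the `u j`.
  have hproj : Real.cos (τ' i) •
      (Real.cos (τ' i) • (b' i : Vec n) + Real.sin (τ' i) • (u' i : Vec n)) =
      Real.cos (τ' i) • ∑ j, c j •
        (Real.cos (τ j) • (b j : Vec n) + Real.sin (τ j) • (u j : Vec n)) := by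
    rw [← hB'.starProjection_left i]
    conv_lhs => rw [hbv]
    rw [map_sum, Finset.smul_sum]
    refine Finset.sum_congr rfl fun j _ => ?_
    rw [map_smul, hB.starProjection_left]
    by_cases hj : c j = 0
    · simp [hj]
    · rw [← hang j hj, smul_comm]
  have hp := smul_right_injective _ hcos hproj
  have hsum : ∑ j, c j • (Real.cos (τ j) • (b j : Vec n) + Real.sin (τ j) • (u j : Vec n)) =
      Real.cos (τ' i) • (b' i : Vec n) + Real.sin (τ' i) • ∑ j, c j • (u j : Vec n) := by
    rw [hbv, Finset.smul_sum, Finset.smul_sum, ← Finset.sum_add_distrib]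
    refine Finset.sum_congr rfl fun j _ => ?_
    by_cases hj : c j = 0
    · simp [hj]
    · rw [← hang j hj]
      module
  have hu : (u' i : Vec n) = ∑ j, c j • (u j : Vec n) :=
    smul_right_injective _ hsin (add_left_cancel (hp.trans hsum))
  have hu' : u' i = ∑ j, c j • u j := Subtype.ext (by simpa using hu)
  rw [h'.apply_basis, hexp, map_sum, hu', Finset.smul_sum]
  refine Finset.sum_congr rfl fun j _ => ?_
  by_cases hj : c j = 0
  · simp [hj]
  · rw [map_smul, h.apply_basis, hang j hj, smul_comm]

/-! ### The Frobenius norm and the linear Eckart–Young theorem -/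

theorem trace_adjoint_comp_self (A : Tangent W) (b : OrthonormalBasis (Fin k) ℝ W.plane) :
    LinearMap.trace ℝ W.plane (A.adjoint ∘ₗ A) = ∑ i, ‖A (b i)‖ ^ 2 := by
  rw [LinearMap.trace_eq_sum_inner _ b]
  refine Finset.sum_congr rfl fun i _ => ?_
  rw [LinearMap.comp_apply, LinearMap.adjoint_inner_right, real_inner_self_eq_norm_sq]

theorem frobNorm_eq (A : Tangent W) (b : OrthonormalBasis (Fin k) ℝ W.plane) :
    frobNorm A = √(∑ i, ‖A (b i)‖ ^ 2) := by
  rw [frobNorm, trace_adjoint_comp_self A b]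

theorem sum_norm_sq_apply_eq (A : Tangent W) (b c : OrthonormalBasis (Fin k) ℝ W.plane) :
    ∑ i, ‖A (b i)‖ ^ 2 = ∑ i, ‖A (c i)‖ ^ 2 := by
  rw [← trace_adjoint_comp_self, trace_adjoint_comp_self A c]

/-- An orthonormal basis of `W` that starts in the kernel of `C`. -/
theorem exists_basis_ker (C : Tangent W) {s : ℕ} (hsk : s ≤ k)
    (hC : Module.finrank ℝ (LinearMap.range C) ≤ k - s) :
    ∃ c : OrthonormalBasis (Fin k) ℝ W.plane, ∀ i : Fin k, (i : ℕ) < s → C (c i) = 0 := by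
  have hrank := C.finrank_range_add_finrank_ker
  rw [W.finrank_eq] at hrank
  obtain ⟨v, hv, hvN⟩ := exists_isONSpan_of_le
    (Submodule.map_subtype_le W.plane (LinearMap.ker C)) W.finrank_eq
    (s := s) (by
      rw [Submodule.finrank_map_subtype_eq]
      omega)
  refine ⟨hv.basis, fun i hi => ?_⟩
  obtain ⟨x, hx, hxv⟩ := hvN i hi
  have : hv.basis i = x := Subtype.ext (by rw [hv.coe_basis]; exact hxv.symm)
  rw [this]
  exact hx

/-- The Eckart-Young theorem with uniqueness, for distinct singular values. -/
theorem IsDiagonal.isBestApprox {A B : Tangent W} {b : OrthonormalBasis (Fin k) ℝ W.plane}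
    {u : Fin k → W.planeᗮ} {τ : Fin k → ℝ} (h : IsDiagonal A b u τ) (h0 : ∀ i, 0 ≤ τ i)
    (hτ : StrictMono τ) {s : ℕ} (hs : 1 ≤ s) (hsk : s ≤ k)
    (hB : ∀ i : Fin k, B (b i) = if (i : ℕ) < s then 0 else A (b i)) :
    IsBestApprox A (k - s) B ∧ ∀ C, IsBestApprox A (k - s) C → C = B := by
  have hnorm : ∀ i, ‖A (b i)‖ ^ 2 = τ i ^ 2 := by
    intro i
    rw [h.norm_sq_apply]
    simp [b.inner_eq_ite]
  have hAB : ∑ i, ‖(A - B) (b i)‖ ^ 2 = ∑ i with (i : Fin k).val < s, τ i ^ 2 := by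
    rw [Finset.sum_filter]
    refine Finset.sum_congr rfl fun i _ => ?_
    rw [LinearMap.sub_apply, hB]
    split_ifs
    · rw [sub_zero, hnorm]
    · simp
  have hrank : Module.finrank ℝ (LinearMap.range B) ≤ k - s := by
    have hcard : (Finset.univ.filter fun i : Fin k => ¬ (i : ℕ) < s).card = k - s := by
      rw [← Finset.compl_filter, Finset.card_compl, Fintype.card_fin, card_filter_val_lt hsk]
    rw [← hcard]
    have hle : LinearMap.range B ≤ Submodule.span ℝ
        (((Finset.univ.filter fun i : Fin k => ¬ (i : ℕ) < s).image fun i => A (b i) :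
          Finset _) : Set W.planeᗮ) := by
      rw [LinearMap.range_eq_map, ← b.toBasis.span_eq, Submodule.map_span, Submodule.span_le]
      rintro _ ⟨_, ⟨i, rfl⟩, rfl⟩
      rw [OrthonormalBasis.coe_toBasis, hB]
      split_ifs with hi
      · exact Submodule.zero_mem _
      · refine Submodule.subset_span ?_
        simp only [Finset.coe_image, Set.mem_image]
        exact ⟨i, by simpa using hi, rfl⟩
    exact (Submodule.finrank_mono hle).trans
      ((finrank_span_finset_le_card _).trans Finset.card_image_le)
  have main : ∀ C : Tangent W, Module.finrank ℝ (LinearMap.range C) ≤ k - s →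
      ∑ i with (i : Fin k).val < s, τ i ^ 2 ≤ ∑ i, ‖(A - C) (b i)‖ ^ 2 ∧
      (∑ i, ‖(A - C) (b i)‖ ^ 2 ≤ ∑ i with (i : Fin k).val < s, τ i ^ 2 → C = B) := by
    intro C hC
    -- On the first `s` vectors of `c` the difference `A - C` is just `A`, so they alone contribute
    -- a weighted sum of the `τ j ^ 2`, bounded below by the `s` smallest.
    obtain ⟨c, hc⟩ := exists_basis_ker C hsk hC
    have hq := IsONSpan.of_basis b
    have hb := IsONSpan.of_basis c
    let t : Fin k → ℝ := fun j => ∑ i with (i : Fin k).val < s, (inner ℝ (b j) (c i) : ℝ) ^ 2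
    have ht := sum_filter_lt_le_sum_mul hs hsk (a := fun j => τ j ^ 2) (t := t)
      (fun i j hij => pow_lt_pow_left₀ (hτ hij) (h0 i) two_ne_zero)
      (fun j => Finset.sum_nonneg fun i _ => sq_nonneg _)
      (fun j => sum_inner_sq_le_one hb hq _ j)
      (sum_sum_inner_sq hb hq hsk fun i _ => (c i).2)
    have hfirst : ∑ i with (i : Fin k).val < s, ‖(A - C) (c i)‖ ^ 2 = ∑ j, τ j ^ 2 * t j := by
      simp only [t, Finset.mul_sum]
      rw [Finset.sum_comm]
      refine Finset.sum_congr rfl fun i hi => ?_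
      rw [LinearMap.sub_apply, hc i (Finset.mem_filter.1 hi).2, sub_zero, h.norm_sq_apply]
    have hsplit := Finset.sum_filter_add_sum_filter_not Finset.univ
      (fun i : Fin k => (i : ℕ) < s) (fun i => ‖(A - C) (c i)‖ ^ 2)
    have hnn : 0 ≤ ∑ i with ¬ (i : Fin k).val < s, ‖(A - C) (c i)‖ ^ 2 :=
      Finset.sum_nonneg fun i _ => sq_nonneg _
    rw [sum_norm_sq_apply_eq (A - C) b c]
    refine ⟨by linarith [ht.1], fun hle => ?_⟩
    have hteq := ht.2 (by linarith)
    have hz := (Finset.sum_eq_zero_iff_of_nonneg fun i _ => sq_nonneg _).1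
      (le_antisymm (by linarith [ht.1]) hnn)
    have hAC : ∀ i : Fin k, ¬ (i : ℕ) < s → (A - C) (c i) = 0 := by
      intro i hi
      have := hz i (by simpa using hi)
      exact norm_eq_zero.1 (pow_eq_zero_iff two_ne_zero |>.1 this)
    have hqb : ∀ j i : Fin k, ¬ (j : ℕ) < s → (i : ℕ) < s → (inner ℝ (b j) (c i) : ℝ) = 0 := by
      intro j i hj hi
      have h1 := hteq j
      rw [if_neg hj] at h1
      have := (Finset.sum_eq_zero_iff_of_nonneg fun i _ => sq_nonneg _).1 h1 i (by simpa using hi)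
      exact pow_eq_zero_iff two_ne_zero |>.1 this
    have hqb' : ∀ j i : Fin k, (j : ℕ) < s → ¬ (i : ℕ) < s → (inner ℝ (b j) (c i) : ℝ) = 0 := by
      intro j i hj hi
      have h1 := hteq j
      rw [if_pos hj] at h1
      have h2 : ∑ i, (inner ℝ (b j) (c i) : ℝ) ^ 2 ≤ 1 :=
        sum_inner_sq_le_one hb hq Finset.univ j
      rw [← Finset.sum_filter_add_sum_filter_not Finset.univ (fun i : Fin k => (i : ℕ) < s)] at h2
      have h3 : 0 ≤ ∑ i with ¬ (i : Fin k).val < s, (inner ℝ (b j) (c i) : ℝ) ^ 2 :=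
        Finset.sum_nonneg fun i _ => sq_nonneg _
      have := (Finset.sum_eq_zero_iff_of_nonneg fun i _ => sq_nonneg _).1
        (le_antisymm (by simp only [t] at h1; linarith) h3) i (by simpa using hi)
      exact pow_eq_zero_iff two_ne_zero |>.1 this
    -- In the equality case `b j` lies in the span of the `c i` with `i < s`, where `C` vanishes, if
    -- `j < s`, and of the remaining `c i`, where `C = A`, otherwise.
    refine b.toBasis.ext fun j => ?_
    rw [OrthonormalBasis.coe_toBasis, hB]
    split_ifs with hj
    · rw [← c.sum_repr' (b j), map_sum]
      refine Finset.sum_eq_zero fun i _ => ?_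
      by_cases hi : (i : ℕ) < s
      · rw [map_smul, hc i hi, smul_zero]
      · rw [real_inner_comm, hqb' j i hj hi, zero_smul, map_zero]
    · rw [eq_comm, ← sub_eq_zero, ← LinearMap.sub_apply, ← c.sum_repr' (b j), map_sum]
      refine Finset.sum_eq_zero fun i _ => ?_
      by_cases hi : (i : ℕ) < s
      · rw [real_inner_comm, hqb j i hj hi, zero_smul, map_zero]
      · rw [map_smul, hAC i hi, smul_zero]
  refine ⟨⟨hrank, fun C hC => ?_⟩, fun C hC => (main C hC.1).2 ?_⟩
  · rw [frobNorm_eq _ b, frobNorm_eq _ b, hAB]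
    exact Real.sqrt_le_sqrt (main C hC).1
  · have := hC.2 B hrank
    rw [frobNorm_eq _ b, frobNorm_eq _ b, hAB,
      Real.sqrt_le_sqrt_iff (Finset.sum_nonneg fun i _ => sq_nonneg _)] at this
    exact this

/-! ### The Eckart–Young point -/

/-- Principal vectors give the Eckart-Young point. -/
theorem exists_eckartYoung {L : Gr k n} {s : ℕ} (hs : 1 ≤ s) (hsk : s ≤ k)
    (hLW : HasDistinctAngles L W) {p q : Fin k → Vec n}
    (h : Biorthogonal L.plane W.plane p q (fun i => Real.cos (principalAngle L W i))) :
    ∃ Em : Gr k n, Em.plane = Submodule.span ℝ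
      (Set.range fun i : Fin k => if (i : ℕ) < s then q i else p i) ∧
      IsEckartYoungPoint W L s Em := by
  obtain ⟨hpos, hmono, hlt⟩ := hLW
  have hpi := Real.pi_pos
  set θ := principalAngle L W
  have hsin : ∀ i, 0 < Real.sin (θ i) := fun i =>
    Real.sin_pos_of_pos_of_lt_pi (hpos i) (by linarith [hlt i])
  let b := h.right.basis
  have hb : ∀ i, (b i : Vec n) = q i := h.right.coe_basis
  -- The normalized component of `p i` orthogonal to `W`; its length before normalization is `sin (θ
  -- i)`, nonzero as `θ i > 0`.
  have hperp : ∀ i, (Real.sin (θ i))⁻¹ • (p i - Real.cos (θ i) • q i) ∈ W.planeᗮ := by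
    intro i
    refine Submodule.smul_mem _ _ ?_
    rw [← h.starProjection_right]
    exact Submodule.sub_starProjection_mem_orthogonal _
  let u : Fin k → W.planeᗮ := fun i => ⟨_, hperp i⟩
  have hu : ∀ i, Real.cos (θ i) • q i + Real.sin (θ i) • (u i : Vec n) = p i := by
    intro i
    simp only [u, smul_smul, mul_inv_cancel₀ (hsin i).ne', one_smul]
    abel
  have huu : ∀ i j, (inner ℝ (u i) (u j) : ℝ) = if i = j then 1 else 0 := by
    intro i j
    rw [Submodule.coe_inner]
    simp only [u, real_inner_smul_left, real_inner_smul_right, inner_sub_left, inner_sub_right,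
      h.left.inner_eq, h.right.inner_eq, h.inner_eq, h.symm.inner_eq]
    by_cases hij : i = j
    · subst hij
      have := (hsin i).ne'
      simp only [if_true]
      field_simp
      linarith [Real.sin_sq_add_cos_sq (θ i)]
    · simp [hij]
  let A : Tangent W := b.toBasis.constr ℝ fun i => θ i • u i
  let B : Tangent W := b.toBasis.constr ℝ fun i => if (i : ℕ) < s then 0 else θ i • u i
  have hAb : ∀ i, A (b i) = θ i • u i := fun i => by
    rw [← b.coe_toBasis]
    exact b.toBasis.constr_basis ℝ _ i
  have hBb : ∀ i : Fin k, B (b i) = if (i : ℕ) < s then 0 else θ i • u i := fun i => by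
    rw [← b.coe_toBasis]
    exact b.toBasis.constr_basis ℝ _ i
  have hA : IsDiagonal A b u θ := ⟨hAb, fun i j => by rw [huu]; simp⟩
  have hBd : IsDiagonal B b u (fun i => if (i : ℕ) < s then 0 else θ i) :=
    ⟨fun i => by rw [hBb]; split_ifs <;> simp, fun i j => by rw [huu]; simp⟩
  have hAL : grExp W A = L := by
    refine Gr.ext ?_
    rw [hA.grExp_plane, ← h.left.span_eq]
    congr 2
    funext i
    rw [hb, hu]
  refine ⟨grExp W B, ?_, A, ⟨⟨hA.singularValues_le (by positivity)
    fun i => ⟨(hpos i).le, (hlt i).le⟩, hAL⟩, fun A' hA' => ?_⟩, B,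
    hA.isBestApprox (fun i => (hpos i).le) hmono hs hsk fun i => by rw [hBb, hAb], rfl⟩
  · rw [hBd.grExp_plane]
    congr 2
    funext i
    rw [hb]
    split_ifs
    · simp
    · exact hu i
  · obtain ⟨b', u', hd⟩ := exists_isDiagonal A'
    exact hA.eq_of_grExp_eq (fun i => ⟨hpos i, hlt i⟩) hd
      (fun i => ⟨A'.singularValues_nonneg i, hA'.1 i⟩) (hA'.2.trans hAL.symm)

end NonlinearEckartYoung

namespace NonlinearEckartYoung

variable {k n : ℕ}

/-! ### Genericity -/

/-- The matrix `(⟨w i, P_E (w j)⟩)`, for a family `w`. -/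
noncomputable def projGram (w : Fin k → Vec n) (E : Gr k n) : Matrix (Fin k) (Fin k) ℝ :=
  Matrix.of fun i j => inner ℝ (w i) (E.plane.starProjection (w j))

/-- `projGram` as a matrix of polynomials in the entries of the projection. -/
noncomputable def projGramPoly (w : Fin k → Vec n) :
    Matrix (Fin k) (Fin k) (MvPolynomial (Fin n × Fin n) ℝ) :=
  Matrix.of fun i j => ∑ a, ∑ b, MvPolynomial.C (w i a * w j b) * MvPolynomial.X (a, b)

theorem map_projGramPoly (w : Fin k → Vec n) (E : Gr k n) :
    (MvPolynomial.eval E.projEntry).mapMatrix (projGramPoly w) = projGram w E := by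
  ext i j
  have hw : w j = ∑ b, w j b • EuclideanSpace.single b (1 : ℝ) := by
    ext a
    simp [Pi.single_apply]
  simp only [projGramPoly, projGram, RingHom.mapMatrix_apply, Matrix.map_apply, Matrix.of_apply,
    map_sum, map_mul, MvPolynomial.eval_C, MvPolynomial.eval_X, Gr.projEntry]
  conv_rhs => rw [hw, map_sum]
  rw [PiLp.inner_apply]
  refine Finset.sum_congr rfl fun a _ => ?_
  simp only [map_smul, RCLike.inner_apply, conj_trivial]
  rw [WithLp.ofLp_sum, Finset.sum_apply, Finset.sum_mul]
  refine Finset.sum_congr rfl fun b _ => ?_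
  simp only [PiLp.smul_apply, smul_eq_mul]
  ring

/-- The matrix of the traces of powers `tr M^{i + j}`; its determinant is the discriminant of the
characteristic polynomial of `M`. -/
def traceHankel {R : Type*} [CommRing R] (M : Matrix (Fin k) (Fin k) R) :
    Matrix (Fin k) (Fin k) R :=
  Matrix.of fun i j => (M ^ ((i : ℕ) + j)).trace

theorem map_traceHankel {R S : Type*} [CommRing R] [CommRing S] (f : R →+* S)
    (M : Matrix (Fin k) (Fin k) R) :
    f.mapMatrix (traceHankel M) = traceHankel (f.mapMatrix M) := by
  ext i j
  simp only [traceHankel, RingHom.mapMatrix_apply, Matrix.map_apply, Matrix.of_apply]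
  rw [← RingHom.mapMatrix_apply, ← map_pow, RingHom.mapMatrix_apply]
  simp [Matrix.trace]

/-- A polynomial that vanishes at a matrix iff one of the eigenvalues is `0`, `1` or multiple. -/
def genericity {R : Type*} [CommRing R] (M : Matrix (Fin k) (Fin k) R) : R :=
  M.det * (1 - M).det * (traceHankel M).det

theorem map_genericity {R S : Type*} [CommRing R] [CommRing S] (f : R →+* S)
    (M : Matrix (Fin k) (Fin k) R) : f (genericity M) = genericity (f.mapMatrix M) := by
  simp only [genericity, map_mul, RingHom.map_det, map_sub, map_one, map_traceHankel]

/-- Conjugation changes neither determinants nor traces of powers. For a diagonal matrix `tr M^{i +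
j}` is a sum of products of powers of the entries, so the trace matrix is `VᵀV` with `V` the
Vandermonde matrix. -/
theorem genericity_conj_diagonal {U V : Matrix (Fin k) (Fin k) ℝ} (h : U * V = 1)
    (d : Fin k → ℝ) : genericity (U * Matrix.diagonal d * V) =
      (∏ i, d i) * (∏ i, (1 - d i)) * (Matrix.vandermonde d).det ^ 2 := by
  have h' : V * U = 1 := mul_eq_one_comm.1 h
  have hdet : U.det * V.det = 1 := by rw [← Matrix.det_mul, h, Matrix.det_one]
  have hconj : ∀ e : Fin k → ℝ, (U * Matrix.diagonal e * V).det = ∏ i, e i := by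
    intro e
    rw [Matrix.det_mul, Matrix.det_mul, Matrix.det_diagonal]
    linear_combination (∏ i, e i) * hdet
  have hpow : ∀ m : ℕ, (U * Matrix.diagonal d * V) ^ m =
      U * Matrix.diagonal (fun i => d i ^ m) * V := by
    intro m
    induction m with
    | zero => simp [h]
    | succ m ih =>
      rw [pow_succ, ih]
      calc _ = U * Matrix.diagonal (fun i => d i ^ m) * (V * U) * Matrix.diagonal d * V := by
            simp only [Matrix.mul_assoc]
        _ = _ := by
            rw [h', Matrix.mul_one, Matrix.mul_assoc U, Matrix.diagonal_mul_diagonal]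
            simp only [pow_succ]
  have h1 : 1 - U * Matrix.diagonal d * V = U * Matrix.diagonal (fun i => 1 - d i) * V := by
    have : Matrix.diagonal (fun i => 1 - d i) = 1 - Matrix.diagonal d := by
      rw [← Matrix.diagonal_one, Matrix.diagonal_sub]
    rw [this, Matrix.mul_sub, Matrix.sub_mul, Matrix.mul_one, h]
  have h2 : traceHankel (U * Matrix.diagonal d * V) =
      (Matrix.vandermonde d).transpose * Matrix.vandermonde d := by
    ext i j
    rw [traceHankel, Matrix.of_apply, hpow, Matrix.trace_mul_cycle, h', Matrix.one_mul,
      Matrix.trace_diagonal, Matrix.mul_apply]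
    simp [Matrix.vandermonde_apply, pow_add]
  rw [genericity, h1, hconj, hconj, h2, Matrix.det_mul, Matrix.det_transpose, sq]

/-- The compression of `P_E` to `W` is diagonal in the basis `q`, with eigenvalues `σ a ^ 2`; the
outer factors change the basis from `q` to `w`. -/
theorem Biorthogonal.projGram_eq {E W : Gr k n} {p q w : Fin k → Vec n} {σ : Fin k → ℝ}
    (h : Biorthogonal E.plane W.plane p q σ) (hw : IsONSpan W.plane w) :
    projGram w E = Matrix.of (fun i a => (inner ℝ (w i) (q a) : ℝ)) *
      Matrix.diagonal (fun a => σ a ^ 2) * Matrix.of (fun a i => (inner ℝ (q a) (w i) : ℝ)) := by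
  ext i j
  rw [projGram, Matrix.of_apply, h.left.starProjection_apply, inner_sum, Matrix.mul_apply]
  refine Finset.sum_congr rfl fun a _ => ?_
  rw [Matrix.mul_diagonal, real_inner_smul_right, h.inner_left (hw.mem j),
    real_inner_comm (p a) (w i), h.inner_left (hw.mem i), Matrix.of_apply, Matrix.of_apply,
    real_inner_comm (w i) (q a)]
  ring

theorem Biorthogonal.genericity_projGram_ne_zero_iff {E W : Gr k n} {p q w : Fin k → Vec n}
    {σ : Fin k → ℝ} (h : Biorthogonal E.plane W.plane p q σ) (hw : IsONSpan W.plane w) :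
    genericity (projGram w E) ≠ 0 ↔
      (∀ i, σ i ≠ 0) ∧ (∀ i, σ i ≠ 1) ∧ Function.Injective σ := by
  have hU : Matrix.of (fun i a => (inner ℝ (w i) (q a) : ℝ)) *
      Matrix.of (fun a i => (inner ℝ (q a) (w i) : ℝ)) = 1 := by
    ext i j
    rw [Matrix.mul_apply, Matrix.one_apply, ← hw.inner_eq]
    conv_rhs => rw [h.right.eq_sum (hw.mem j), inner_sum]
    refine Finset.sum_congr rfl fun a _ => ?_
    rw [real_inner_smul_right, Matrix.of_apply, Matrix.of_apply, mul_comm]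
  have hinj : Function.Injective (fun a => σ a ^ 2) ↔ Function.Injective σ :=
    ⟨fun hi a b hab => hi (by simp only [hab]), fun hi a b hab =>
      hi ((pow_left_inj₀ (h.nonneg a) (h.nonneg b) two_ne_zero).1 hab)⟩
  have h1 : ∀ i, 1 - σ i ^ 2 ≠ 0 ↔ σ i ≠ 1 := fun i => by
    rw [sub_ne_zero, ne_comm, Ne, pow_eq_one_iff_of_nonneg (h.nonneg i) two_ne_zero]
  rw [h.projGram_eq hw, genericity_conj_diagonal hU, mul_ne_zero_iff, mul_ne_zero_iff,
    Finset.prod_ne_zero_iff, Finset.prod_ne_zero_iff, pow_ne_zero_iff two_ne_zero,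
    Matrix.det_vandermonde_ne_zero_iff, hinj, and_assoc]
  simp [h1]

theorem hasDistinctAngles_of_ne {L W : Gr k n}
    (h0 : ∀ i, Real.cos (principalAngle L W i) ≠ 0)
    (h1 : ∀ i, Real.cos (principalAngle L W i) ≠ 1)
    (hinj : Function.Injective fun i => Real.cos (principalAngle L W i)) :
    HasDistinctAngles L W := by
  refine ⟨fun i => (principalAngle_mem L W i).1.lt_of_ne fun h => h1 i ?_,
    (monotone_principalAngle L W).strictMono_of_injective fun i j hij => hinj (by simp only [hij]),
    fun i => (principalAngle_mem L W i).2.lt_of_ne fun h => h0 i ?_⟩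
  · rw [← h, Real.cos_zero]
  · rw [h, Real.cos_pi_div_two]

/-- A unit vector in `L ⊓ W` would be fixed by `P_L`, but `P_L` shortens every nonzero vector of `W`
when all cosines are below `1`. -/
theorem notMem_schubert_of_hasDistinctAngles {L W : Gr k n} {s : ℕ} (hs : 1 ≤ s)
    (h : HasDistinctAngles L W) : L ∉ schubert W s := by
  intro hL
  obtain ⟨x, hx, hx1, -⟩ := exists_unit_orthogonal (L.plane ⊓ W.plane)
    (m := 0) (lt_of_lt_of_le hs hL) Fin.elim0
  obtain ⟨p, q, hb⟩ := exists_biorthogonal L W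
  have h1 := hb.norm_sq_starProjection_left hx.2
  rw [Submodule.starProjection_eq_self_iff.2 hx.1, hb.right.norm_sq_eq hx.2] at h1
  have hlt : ∀ i, Real.cos (principalAngle L W i) ^ 2 < 1 := by
    intro i
    have h2 := Real.sin_pos_of_pos_of_lt_pi (h.1 i) (by linarith [h.2.2 i, Real.pi_pos])
    nlinarith [Real.sin_sq_add_cos_sq (principalAngle L W i)]
  have hle : ∀ i ∈ Finset.univ, Real.cos (principalAngle L W i) ^ 2 * (inner ℝ (q i) x : ℝ) ^ 2 ≤
      (inner ℝ (q i) x : ℝ) ^ 2 := fun i _ => mul_le_of_le_one_left (sq_nonneg _) (hlt i).le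
  have h3 := (Finset.sum_eq_sum_iff_of_le hle).1 h1.symm
  have h4 : ∀ i ∈ Finset.univ, (inner ℝ (q i) x : ℝ) ^ 2 = 0 := by
    intro i hi
    by_contra hne
    exact (hlt i).ne ((mul_eq_right₀ hne).1 (h3 i hi))
  have h5 := hb.right.norm_sq_eq hx.2
  rw [Finset.sum_eq_zero h4, hx1] at h5
  norm_num at h5

/-- The vectors at angle `θ i` from `q i`, in the direction of `r i`. -/
noncomputable def angleVector (q r : Fin k → Vec n) (θ : Fin k → ℝ) (i : Fin k) : Vec n :=
  Real.cos (θ i) • q i + Real.sin (θ i) • r i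

theorem orthonormal_angleVector {q r : Fin k → Vec n} (hq : Orthonormal ℝ q)
    (hr : Orthonormal ℝ r) (hqr : ∀ i j, inner ℝ (q i) (r j) = (0 : ℝ)) (θ : Fin k → ℝ) :
    Orthonormal ℝ (angleVector q r θ) := by
  rw [orthonormal_iff_ite] at hq hr ⊢
  intro i j
  have hrq : ∀ i j, inner ℝ (r i) (q j) = (0 : ℝ) := fun i j => by rw [real_inner_comm, hqr]
  simp only [angleVector, inner_add_left, inner_add_right, real_inner_smul_left,
    real_inner_smul_right, hq, hr, hqr, hrq]
  by_cases hij : i = j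
  · subst hij
    simp only [if_true]
    linarith [Real.sin_sq_add_cos_sq (θ i)]
  · simp [hij]

/-- The plane with given principal vectors `q` in `W`, angles `θ` and normal directions `r`. -/
noncomputable def anglePlane {q r : Fin k → Vec n} (hq : Orthonormal ℝ q)
    (hr : Orthonormal ℝ r) (hqr : ∀ i j, inner ℝ (q i) (r j) = (0 : ℝ)) (θ : Fin k → ℝ) :
    Gr k n where
  plane := Submodule.span ℝ (Set.range (angleVector q r θ))
  finrank_eq := by
    rw [finrank_span_eq_card (orthonormal_angleVector hq hr hqr θ).linearIndependent,
      Fintype.card_fin]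

theorem isONSpan_anglePlane {q r : Fin k → Vec n} (hq : Orthonormal ℝ q)
    (hr : Orthonormal ℝ r) (hqr : ∀ i j, inner ℝ (q i) (r j) = (0 : ℝ)) (θ : Fin k → ℝ) :
    IsONSpan (anglePlane hq hr hqr θ).plane (angleVector q r θ) :=
  ⟨orthonormal_angleVector hq hr hqr θ, rfl⟩

/-- The topology comes from orthogonal projections, and here the projection is a sum of rank-one
operators built from vectors that are continuous in `θ`. -/
theorem continuous_anglePlane {q r : Fin k → Vec n} (hq : Orthonormal ℝ q)
    (hr : Orthonormal ℝ r) (hqr : ∀ i j, inner ℝ (q i) (r j) = (0 : ℝ)) :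
    Continuous (anglePlane hq hr hqr) := by
  rw [continuous_induced_rng]
  have hv : ∀ i, Continuous fun θ => angleVector q r θ i := fun i => by
    unfold angleVector
    fun_prop
  have : (fun E : Gr k n => E.plane.starProjection) ∘ anglePlane hq hr hqr = fun θ =>
      ∑ i, (innerSL ℝ (angleVector q r θ i)).smulRight (angleVector q r θ i) := by
    funext θ
    ext1 x
    rw [Function.comp_apply, (isONSpan_anglePlane hq hr hqr θ).starProjection_apply]
    simp
  rw [this]
  refine continuous_finsetSum _ fun i _ => ?_
  exact ((ContinuousLinearMap.smulRightL ℝ (Vec n) (Vec n)).continuous.comp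
    ((innerSL ℝ).continuous.comp (hv i))).clm_apply (hv i)

theorem biorthogonal_anglePlane {W : Gr k n} {q r : Fin k → Vec n} (hq : IsONSpan W.plane q)
    (hr : Orthonormal ℝ r) (hqr : ∀ i j, inner ℝ (q i) (r j) = (0 : ℝ)) {θ : Fin k → ℝ}
    (hθ : ∀ i, θ i ∈ Set.Icc 0 (Real.pi / 2)) :
    Biorthogonal (anglePlane hq.orthonormal hr hqr θ).plane W.plane (angleVector q r θ) q
      (fun i => Real.cos (θ i)) where
  left := isONSpan_anglePlane _ _ _ _
  right := hq
  inner_eq i j := by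
    rw [angleVector, inner_add_left, real_inner_smul_left, real_inner_smul_left,
      real_inner_comm (q j) (r i), hqr, hq.inner_eq]
    simp
  nonneg i := Real.cos_nonneg_of_mem_Icc ⟨by linarith [(hθ i).1, Real.pi_pos], (hθ i).2⟩

/-- Every plane has a normal form with respect to `W`. -/
theorem exists_eq_anglePlane (hkn : k + k ≤ n) (L W : Gr k n) :
    ∃ (q r : Fin k → Vec n) (hq : IsONSpan W.plane q) (hr : Orthonormal ℝ r)
      (hqr : ∀ i j, inner ℝ (q i) (r j) = (0 : ℝ)),
      L = anglePlane hq.orthonormal hr hqr (principalAngle L W) := by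
  obtain ⟨p, q, h⟩ := exists_biorthogonal L W
  set θ := principalAngle L W with hθ
  have hcardW : Module.finrank ℝ W.planeᗮ = n - k := by
    have := W.plane.finrank_add_finrank_orthogonal
    rw [W.finrank_eq, finrank_euclideanSpace, Fintype.card_fin] at this
    omega
  have hd : ∀ i, p i - Real.cos (θ i) • q i ∈ W.planeᗮ := fun i => by
    rw [← h.starProjection_right]
    exact Submodule.sub_starProjection_mem_orthogonal _
  have hdd : ∀ i j, (inner ℝ (p i - Real.cos (θ i) • q i) (p j - Real.cos (θ j) • q j) : ℝ) =
      if i = j then Real.sin (θ i) ^ 2 else 0 := by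
    intro i j
    simp only [real_inner_smul_left, real_inner_smul_right, inner_sub_left, inner_sub_right,
      h.left.inner_eq, h.right.inner_eq, h.inner_eq, h.symm.inner_eq]
    by_cases hij : i = j
    · subst hij
      simp only [if_true]
      linarith [Real.sin_sq_add_cos_sq (θ i)]
    · simp [hij]
  -- Only the indices with `sin (θ i) ≠ 0` give prescribed unit normals. Extending these to an
  -- orthonormal basis of `W^⊥` supplies directions for the zero angles; `k ≤ n - k` makes room for
  -- all of them.
  let v : Fin (n - k) → W.planeᗮ := fun a =>
    if ha : (a : ℕ) < k then
      ⟨(Real.sin (θ ⟨a, ha⟩))⁻¹ • (p ⟨a, ha⟩ - Real.cos (θ ⟨a, ha⟩) • q ⟨a, ha⟩),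
        Submodule.smul_mem _ _ (hd _)⟩ else 0
  let S : Set (Fin (n - k)) := {a | ∃ i : Fin k, Fin.castLE (by omega) i = a ∧ Real.sin (θ i) ≠ 0}
  have hvi : ∀ i : Fin k, (v (Fin.castLE (by omega) i) : Vec n) =
      (Real.sin (θ i))⁻¹ • (p i - Real.cos (θ i) • q i) := by
    intro i
    simp only [v, Fin.val_castLE, dif_pos i.2]
  have hvS : Orthonormal ℝ (S.domRestrict v) := by
    rw [orthonormal_iff_ite]
    rintro ⟨_, i, rfl, hi⟩ ⟨_, j, rfl, hj⟩
    rw [Set.domRestrict_apply, Set.domRestrict_apply, Submodule.coe_inner, hvi, hvi,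
      real_inner_smul_left, real_inner_smul_right, hdd]
    by_cases hij : i = j
    · subst hij
      simp only [if_true]
      field_simp
    · have : (⟨Fin.castLE (by omega : k ≤ n - k) i, i, rfl, hi⟩ : S) ≠
          ⟨Fin.castLE (by omega) j, j, rfl, hj⟩ := by
        intro he
        exact hij (Fin.castLE_injective (by omega) (congrArg Subtype.val he))
      simp [hij, this]
  obtain ⟨b, hb⟩ := hvS.exists_orthonormalBasis_extension_of_card_eq (by simpa using hcardW)
  let r : Fin k → Vec n := fun i => b (Fin.castLE (by omega) i)
  have hr : Orthonormal ℝ r :=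
    (IsONSpan.of_basis b).orthonormal.comp _ (Fin.castLE_injective (by omega))
  have hqr : ∀ i j, inner ℝ (q i) (r j) = (0 : ℝ) := fun i j => (b _).2 _ (h.right.mem i)
  refine ⟨q, r, h.right, hr, hqr, Gr.ext ?_⟩
  refine h.left.span_eq.symm.trans ?_
  change _ = Submodule.span ℝ (Set.range _)
  congr 2
  funext i
  rw [angleVector]
  by_cases hi : Real.sin (θ i) = 0
  · have h0 := hdd i i
    rw [if_pos rfl, hi, real_inner_self_eq_norm_sq] at h0
    have h1 : p i - Real.cos (θ i) • q i = 0 := by simpa using h0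
    rw [hi, zero_smul, add_zero, sub_eq_zero.1 h1]
  · have : r i = (Real.sin (θ i))⁻¹ • (p i - Real.cos (θ i) • q i) := by
      rw [← hvi]
      exact congrArg Subtype.val (hb _ ⟨i, rfl, hi⟩)
    rw [this, smul_smul, mul_inv_cancel₀ hi, one_smul]
    abel

/-- Keep the directions `q`, `r` of `L` and move its angles linearly towards distinct angles in `(0,
π / 2)`. Every plane strictly between the two ends has distinct angles in that interval, and the
path converges to `L`. -/
theorem dense_hasDistinctAngles (hkn : k + k ≤ n) {W : Gr k n} {w : Fin k → Vec n}
    (hw : IsONSpan W.plane w) : Dense {E : Gr k n | genericity (projGram w E) ≠ 0} := by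
  intro L
  obtain ⟨q, r, hq, hr, hqr, hL⟩ := exists_eq_anglePlane hkn L W
  set θ := principalAngle L W with hθ
  have hpi := Real.pi_pos
  -- The shift `i + 1` and the denominator `k + 1` keep these equally spaced angles away from `0`
  -- and `π / 2`.
  let φ : Fin k → ℝ := fun i => Real.pi / 2 * (((i : ℕ) + 1) / (k + 1))
  have hφ : StrictMono φ := by
    intro i j hij
    have : ((i : ℕ) : ℝ) < (j : ℕ) := by exact_mod_cast hij
    simp only [φ]
    gcongr
  have hφm : ∀ i, φ i ∈ Set.Ioo 0 (Real.pi / 2) := by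
    intro i
    have : ((i : ℕ) : ℝ) < k := by exact_mod_cast i.2
    refine ⟨by positivity, ?_⟩
    have h1 : (((i : ℕ) : ℝ) + 1) / (k + 1) < 1 := (div_lt_one (by positivity)).2 (by linarith)
    simp only [φ]
    nlinarith
  let γ : ℝ → Fin k → ℝ := fun t i => (1 - t) * θ i + t * φ i
  have hγ : Continuous fun t => anglePlane hq.orthonormal hr hqr (γ t) :=
    (continuous_anglePlane hq.orthonormal hr hqr).comp (by fun_prop)
  have h0 : anglePlane hq.orthonormal hr hqr (γ 0) = L := by
    have : γ 0 = θ := by funext i; simp [γ]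
    rw [this]
    exact hL.symm
  have hlim := (hγ.tendsto 0).mono_left (nhdsWithin_le_nhds (s := Set.Ioi 0))
  rw [h0] at hlim
  refine mem_closure_of_tendsto hlim ?_
  filter_upwards [Ioo_mem_nhdsGT (zero_lt_one (α := ℝ))] with t ht
  have hm : ∀ i, γ t i ∈ Set.Ioo 0 (Real.pi / 2) := by
    intro i
    obtain ⟨a1, a2⟩ := principalAngle_mem L W i
    obtain ⟨b1, b2⟩ := hφm i
    obtain ⟨t0, t1⟩ := ht
    rw [← hθ] at a1 a2
    simp only [γ]
    constructor <;> nlinarith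
  have hmono : StrictMono (γ t) := by
    intro i j hij
    have h1 : θ i ≤ θ j := monotone_principalAngle L W hij.le
    have h2 := hφ hij
    obtain ⟨t0, t1⟩ := ht
    simp only [γ]
    nlinarith
  refine ((biorthogonal_anglePlane hq hr hqr fun i =>
    ⟨(hm i).1.le, (hm i).2.le⟩).genericity_projGram_ne_zero_iff hw).2 ⟨fun i => ?_, fun i => ?_, ?_⟩
  · exact (Real.cos_pos_of_mem_Ioo ⟨by linarith [(hm i).1], (hm i).2⟩).ne'
  · have := Real.cos_lt_cos_of_nonneg_of_le_pi le_rfl (by linarith [(hm i).2]) (hm i).1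
    rw [Real.cos_zero] at this
    exact this.ne
  · intro i j hij
    exact hmono.injective (Real.injOn_cos ⟨(hm i).1.le, by linarith [(hm i).2]⟩
      ⟨(hm j).1.le, by linarith [(hm j).2]⟩ hij)

theorem isGeneric_hasDistinctAngles (hkn : k + k ≤ n) {s : ℕ} (hs : 1 ≤ s) (W : Gr k n) :
    IsGeneric (fun L : Gr k n => L ∉ schubert W s ∧ HasDistinctAngles L W) := by
  obtain ⟨w, hw, -⟩ := exists_isONSpan_of_le (le_refl W.plane) W.finrank_eq (Nat.zero_le _)
  have heval : ∀ E : Gr k n, MvPolynomial.eval E.projEntry (genericity (projGramPoly w)) =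
      genericity (projGram w E) := fun E => by rw [map_genericity, map_projGramPoly]
  refine ⟨genericity (projGramPoly w), ?_, fun L hL => ?_⟩
  · simp_rw [heval]
    exact dense_hasDistinctAngles hkn hw
  · rw [heval] at hL
    obtain ⟨p, q, h⟩ := exists_biorthogonal L W
    obtain ⟨h0, h1, hinj⟩ := (h.genericity_projGram_ne_zero_iff hw).1 hL
    have := hasDistinctAngles_of_ne h0 h1 hinj
    exact ⟨notMem_schubert_of_hasDistinctAngles hs this, this⟩

end NonlinearEckartYoung

open NonlinearEckartYoung in
theorem theorem4 (k n s : ℕ) (hkn : k + k ≤ n) (hs : 1 ≤ s) (hsk : s ≤ k) (W : Gr k n) :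
    IsGeneric (fun L : Gr k n => L ∉ schubert W s ∧ HasDistinctAngles L W) ∧
    ∀ L : Gr k n, HasDistinctAngles L W →
      ∀ p q : Fin k → Vec n, IsPrincipalVectors L.plane W.plane p q →
        ∃ Em : Gr k n,
          Em.plane = Submodule.span ℝ
            (Set.range fun i : Fin k => if (i : ℕ) < s then q i else p i) ∧
          Em ∈ schubert W s ∧
          (∀ E ∈ schubert W s, E ≠ Em → grassmannDist L Em < grassmannDist L E) ∧
          grassmannDist L Em =
            √(∑ i ∈ Finset.univ.filter (fun i : Fin k => (i : ℕ) < s), principalAngle L W i ^ 2) ∧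
          IsEckartYoungPoint W L s Em := by
  refine ⟨isGeneric_hasDistinctAngles hkn hs W, fun L hL p q hpq => ?_⟩
  have h := hpq.biorthogonal_cos
  obtain ⟨Em, hEm, hEY⟩ := exists_eckartYoung hs hsk hL h
  exact ⟨Em, hEm, mem_schubert_mixed hsk h.right hEm,
    fun E hE hne => grassmannDist_mixed_lt hs hsk hL h hEm hE hne, grassmannDist_mixed h hEm, hEY⟩
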